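/- Let $X\subset\mathbb{C}^n$ and $Y\subset\mathbb{C}^m$ be non-empty affine algebraic varieties (common zero sets of complex polynomials, not necessarily irreducible), and let $f\colon X\to Y$ be an algebraic bi-Lipschitz homeomorphism, that is, a homeomorphism whose graph is an algebraic subset of $\mathbb{C}^n\times\mathbb{C}^m$ and for which there is a constant $K>0$ with $$\frac1K\,\|x-x'\|\le\|f(x)-f(x')\|\le K\,\|x-x'\|\qquad\text{for all }x,x'\in X.$$ Then $\deg X=\deg Y$. Here the degree of a non-empty affine algebraic variety $Z\subset\mathbb{C}^N$ of dimension $k$ is the number of points in which $Z$ meets a generic affine linear subspace of $\mathbb{C}^N$ of codimension $k$, i.e. the number $d$ such that $\#\{z\in Z: Az=b\}=d$ for all $(A,b)$ in a non-empty Zariski open subset of $\mathbb{C}^{k\times N}\times\mathbb{C}^k$. -/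

import Mathlib

namespace AffineDegree

/-- `X ⊆ ℂ^σ` is an affine algebraic set (affine variety, not assumed irreducible): the common zero
set of an ideal of polynomials. -/
def IsAlgebraicSet {σ : Type*} (X : Set (σ → ℂ)) : Prop :=
  ∃ I : Ideal (MvPolynomial σ ℂ), X = MvPolynomial.zeroLocus ℂ I

/-- The dimension of `X ⊆ ℂ^σ`: the Krull dimension of its coordinate ring `ℂ[x] / I(X)`
(it is `⊥` for the empty set). -/
noncomputable def dimension {σ : Type*} (X : Set (σ → ℂ)) : WithBot ℕ∞ :=
  ringKrullDim (MvPolynomial σ ℂ ⧸ MvPolynomial.vanishingIdeal ℂ X)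

/-- The affine linear subspace of `ℂ^σ` cut out by the `k` linear equations `A x = b`;
for generic `(A, b)` (and `k` at most the dimension of `ℂ^σ`) it has codimension `k`. -/
def linearSection {σ : Type*} [Fintype σ] {k : ℕ} (A : Matrix (Fin k) σ ℂ) (b : Fin k → ℂ) :
    Set (σ → ℂ) :=
  {x | A.mulVec x = b}

/-- A property of systems `(A, b)` of `k` linear equations on `ℂ^σ` holds generically if it holds on
a non-empty Zariski open set of such systems, that is (shrinking it) wherever some nonzero
polynomial in the entries of `A` and `b` does not vanish. -/
def Generically {σ : Type*} {k : ℕ} (p : Matrix (Fin k) σ ℂ → (Fin k → ℂ) → Prop) : Prop :=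
  ∃ P : MvPolynomial ((Fin k × σ) ⊕ Fin k) ℂ, P ≠ 0 ∧
    ∀ (A : Matrix (Fin k) σ ℂ) (b : Fin k → ℂ),
      MvPolynomial.eval (Sum.elim (fun ij => A ij.1 ij.2) b) P ≠ 0 → p A b

/-- `X` has degree `d`: a generic affine linear subspace of codimension `k = dim X` meets `X` in
exactly `d` points. -/
def HasDegree {σ : Type*} [Fintype σ] (X : Set (σ → ℂ)) (d : ℕ) : Prop :=
  ∃ k : ℕ, dimension X = (k : WithBot ℕ∞) ∧
    Generically fun (A : Matrix (Fin k) σ ℂ) (b : Fin k → ℂ) =>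
      (X ∩ linearSection A b).encard = (d : ℕ∞)

/-- The degree is unique: `HasDegree X d` determines `d`. -/
theorem HasDegree.unique {σ : Type*} [Fintype σ] {X : Set (σ → ℂ)} {d e : ℕ}
    (hd : HasDegree X d) (he : HasDegree X e) : d = e := by
  obtain ⟨k, hk, P, hP, hPd⟩ := hd
  obtain ⟨l, hl, Q, hQ, hQe⟩ := he
  obtain rfl : k = l := by
    have h := hk.symm.trans hl
    exact_mod_cast h
  obtain ⟨v, hv⟩ : ∃ v, MvPolynomial.eval v (P * Q) ≠ 0 := by
    by_contra! h
    exact mul_ne_zero hP hQ (MvPolynomial.funext fun v => by simpa using h v)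
  rw [map_mul] at hv
  have hve : v = Sum.elim (fun ij : Fin k × σ =>
      (Matrix.of fun i j => v (Sum.inl (i, j))) ij.1 ij.2) (fun i => v (Sum.inr i)) := by
    ext (ij | i) <;> rfl
  have h1 := hPd _ _ (hve ▸ left_ne_zero_of_mul hv)
  have h2 := hQe _ _ (hve ▸ right_ne_zero_of_mul hv)
  have h := h1.symm.trans h2
  exact_mod_cast h

/-- The graph of `f : X → Y` as a subset of `ℂ^σ × ℂ^τ = ℂ^(σ ⊕ τ)`. -/
def graph {σ τ : Type*} {X : Set (σ → ℂ)} {Y : Set (τ → ℂ)} (f : X → Y) : Set (σ ⊕ τ → ℂ) :=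
  {z | ∃ x : X, z = Sum.elim (x : σ → ℂ) (f x : τ → ℂ)}

/-- `f` is bi-Lipschitz: `K⁻¹ ‖x - x'‖ ≤ ‖f x - f x'‖ ≤ K ‖x - x'‖` for some constant `K`, where
`X` and `Y` carry the metrics induced from the ambient spaces. (The norm on `ℂ^n` used here is the
maximum norm; all norms on `ℂ^n` are equivalent, so they give the same notion.) -/
def IsBiLipschitz {σ τ : Type*} [Fintype σ] [Fintype τ] {X : Set (σ → ℂ)} {Y : Set (τ → ℂ)}
    (f : X → Y) : Prop :=
  ∃ K : NNReal, LipschitzWith K f ∧ AntilipschitzWith K f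

end AffineDegree

/-! Both degrees are read off from one filtered ring: the coordinate ring `R` of the graph Γ of `f`,
filtered by the powers of the span V of 1 and all coordinates of both ambient spaces.

Let k = dim Γ, and let t₁, …, t_k in V satisfy V^(E+1) ⊆ ⟨1, t⟩·V^E for some E. Then `R` is finite
over ℂ[t], and the growth of dim V^s, compared with the dimension of the polynomials of degree at
most s in k variables, determines the rank. So the rank is the same for every such t
(`rankOver_le_of_isFilteredFinite`, used in both directions). In characteristic zero, with `R`
reduced, this rank is also the number of points in a generic fibre of t (`rankOver_eq`). If the t_i
are generic linear forms in the coordinates of X alone, these fibres are the generic linear sections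
of X, because Γ → X is bijective; the rank is then deg X. The same holds for Y
(`exists_rankOver_eq`).

It remains to see that linear forms in the coordinates of X alone can be compatible with a
filtration that also involves those of Y. This is the role of the Lipschitz condition, used only
through the growth bound ‖f(x)‖ ≤ K‖x‖ + D. The bound makes the coordinates of Y, placed in degree
one, integral over the Rees algebra of ⟨1, x⟩ (`isReesIntegral_of_norm_le`). Behind it is an
analytic criterion: a regular function bounded wherever the g_i are bounded is integral over ℂ[g]
(`isIntegral_of_bounded`), applied here to R[T]. Noether normalization by linear forms, in Rees form
(`exists_finrank_le_isReesIntegral`), is an open condition on the forms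
(`exists_forall_isFilteredFinite`), and transitivity of integrality finishes the argument.

That the degrees exist at all is a separate matter: the generic fibre count is applied to the
universal family of linear sections (`IsAlgebraicSet.exists_hasDegree`). -/

namespace AffineDegree

/-! ### Complex points of finitely generated algebras -/

section Points

/-- Every maximal ideal of a finitely generated `ℂ`-algebra is the kernel of a `ℂ`-point. -/
theorem exists_algHom_ker_eq {B : Type*} [CommRing B] [Algebra ℂ B] [Algebra.FiniteType ℂ B]
    (m : Ideal B) [hm : m.IsMaximal] : ∃ z : B →ₐ[ℂ] ℂ, RingHom.ker z = m := by
  let _ := Ideal.Quotient.field m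
  have : Module.Finite ℂ (B ⧸ m) := finite_of_finite_type_of_isJacobsonRing ℂ (B ⧸ m)
  let φ : (B ⧸ m) →ₐ[ℂ] ℂ := IsAlgClosed.lift
  refine ⟨φ.comp (Ideal.Quotient.mkₐ ℂ m), ?_⟩
  ext x
  rw [RingHom.mem_ker, AlgHom.comp_apply, map_eq_zero_iff φ φ.toRingHom.injective]
  exact Ideal.Quotient.eq_zero_iff_mem

theorem algHom_eq_of_ker_le {B : Type*} [CommRing B] [Algebra ℂ B] {z w : B →ₐ[ℂ] ℂ}
    (h : RingHom.ker z ≤ RingHom.ker w) : z = w := by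
  ext b
  have : b - algebraMap ℂ B (z b) ∈ RingHom.ker z := by simp [RingHom.mem_ker]
  have := h this
  rw [RingHom.mem_ker, map_sub, AlgHom.commutes, sub_eq_zero] at this
  exact this.symm

end Points

theorem isIntegral_map_subalgebra {k B C : Type*} [CommRing k] [CommRing B] [CommRing C]
    [Algebra k B] [Algebra k C] {A : Subalgebra k B} (f : B →ₐ[k] C) {x : B}
    (hx : IsIntegral A x) : IsIntegral (A.map f) (f x) :=
  hx.map_of_comp_eq (φ := ((f.comp A.val).codRestrict (A.map f) fun a =>
    Subalgebra.mem_map.mpr ⟨a, a.2, rfl⟩).toRingHom) (ψ := f.toRingHom) rfl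

/-! ### Krull dimension and algebraic dependence -/

section Dimension

/-- Lying over and going up lift chains of primes from `A` to `B`; incomparability keeps chains
strict when they are contracted back. -/
theorem ringKrullDim_eq_of_isIntegral {A B : Type*} [CommRing A] [CommRing B] [Algebra A B]
    [Algebra.IsIntegral A B] (h : Function.Injective (algebraMap A B)) :
    ringKrullDim A = ringKrullDim B := by
  apply le_antisymm
  · refine iSup_le fun l => ?_
    have : FaithfulSMul A B := (faithfulSMul_iff_algebraMap_injective A B).mpr h
    obtain ⟨Q, -, hQ, hQl⟩ := Ideal.exists_ideal_over_prime_of_isIntegral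
      (S := B) l.head.asIdeal ⊥ (by
        rw [← RingHom.ker_eq_comap_bot, (RingHom.injective_iff_ker_eq_bot _).mp h]; exact bot_le)
    have : Q.LiesOver l.head.asIdeal := ⟨hQl.symm⟩
    obtain ⟨L, hL, -⟩ := Ideal.exists_ltSeries_of_hasGoingUp l Q
    rw [← hL]
    exact le_iSup (fun p : LTSeries (PrimeSpectrum B) => ((p.length : ℕ∞) : WithBot ℕ∞)) L
  · exact Order.krullDim_le_of_strictMono (PrimeSpectrum.comap (algebraMap A B))
      fun I J hIJ => Ideal.IsIntegral.comap_lt_comap (R := A) hIJ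

theorem exists_ringKrullDim_eq (R : Type*) [CommRing R] [Nontrivial R] [Algebra ℂ R]
    [Algebra.FiniteType ℂ R] :
    ∃ (k : ℕ) (y : Fin k → R), ringKrullDim R = k ∧
      Algebra.IsIntegral (Algebra.adjoin ℂ (Set.range y)) R := by
  obtain ⟨s, g, hg, hi⟩ := exists_integral_inj_algHom_of_fg ℂ R
  refine ⟨s, fun i => g (.X i), ?_, ?_⟩
  · let _ := g.toRingHom.toAlgebra
    have : Algebra.IsIntegral (MvPolynomial (Fin s) ℂ) R := ⟨hi⟩
    rw [← ringKrullDim_eq_of_isIntegral (A := MvPolynomial (Fin s) ℂ) (B := R) hg,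
      MvPolynomial.ringKrullDim_of_isNoetherianRing]
    simp
  · have hr : Algebra.adjoin ℂ (Set.range fun i => g (.X i)) = g.range := by
      rw [Algebra.adjoin_range_eq_range_aeval]
      congr 1
      ext i
      simp
    rw [hr]
    refine ⟨fun x => ?_⟩
    obtain ⟨p, hp, hx⟩ := hi x
    refine ⟨p.map g.rangeRestrict.toRingHom, hp.map _, ?_⟩
    rw [Polynomial.eval₂_map]
    exact hx

/-- In a ring that is integral over the subalgebra generated by `ι`-many elements, any strictly
larger finite family satisfies a polynomial relation. -/
theorem exists_relation {ι κ R : Type} [Fintype ι] [Fintype κ] [CommRing R] [Algebra ℂ R]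
    (y : ι → R) [Algebra.IsIntegral (Algebra.adjoin ℂ (Set.range y)) R] (u : κ → R)
    (h : Fintype.card ι < Fintype.card κ) :
    ∃ f : MvPolynomial κ ℂ, f ≠ 0 ∧ MvPolynomial.aeval u f = 0 := by
  by_contra! hu
  have hinj : Function.Injective (MvPolynomial.aeval (R := ℂ) u) := by
    rw [injective_iff_map_eq_zero]
    intro f hf
    by_contra h0
    exact hu f h0 hf
  -- A prime avoiding all nonzero polynomials in `u` keeps `u` algebraically independent in the
  -- quotient domain, where transcendence degree can be compared with the number of generators `y`.
  let M : Submonoid R := (nonZeroDivisors (MvPolynomial κ ℂ)).map (MvPolynomial.aeval (R := ℂ) u)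
  have hM : Disjoint ((⊥ : Ideal R) : Set R) (M : Set R) := by
    rw [Set.disjoint_left]
    rintro x hx ⟨f, hf, rfl⟩
    exact hu f (nonZeroDivisors.ne_zero hf) hx
  obtain ⟨q, hq, -, hqM⟩ := Ideal.exists_le_prime_disjoint _ M hM
  let π := Ideal.Quotient.mkₐ ℂ q
  have hind : AlgebraicIndependent ℂ (fun i => π (u i)) := by
    rw [algebraicIndependent_iff]
    intro f hf
    by_contra h0
    have : π (MvPolynomial.aeval u f) = 0 := by
      rw [← hf]
      exact MvPolynomial.comp_aeval_apply u π f
    exact Set.disjoint_left.mp hqM (Ideal.Quotient.eq_zero_iff_mem.mp this)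
      ⟨f, mem_nonZeroDivisors_of_ne_zero h0, rfl⟩
  have halg : Algebra.IsIntegral (Algebra.adjoin ℂ (Set.range fun i => π (y i))) (R ⧸ q) := by
    refine ⟨fun x => ?_⟩
    obtain ⟨x, rfl⟩ := Ideal.Quotient.mk_surjective x
    have hle : (Algebra.adjoin ℂ (Set.range y)).map π =
        Algebra.adjoin ℂ (Set.range fun i => π (y i)) := by
      rw [AlgHom.map_adjoin, ← Set.range_comp]
      rfl
    rw [← hle]
    exact isIntegral_map_subalgebra π (Algebra.IsIntegral.isIntegral x)
  have h1 := hind.cardinalMk_le_trdeg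
  have h2 := Algebra.IsAlgebraic.trdeg_le_cardinalMk ℂ (Set.range fun i => π (y i))
  have h3 : Cardinal.mk (Set.range fun i => π (y i)) ≤ Cardinal.mk ι := Cardinal.mk_range_le
  have := (h1.trans h2).trans h3
  simp only [Cardinal.mk_fintype, Nat.cast_le] at this
  omega

end Dimension

open scoped TensorProduct

/-! ### Counting points in generic fibres -/

section GenericFiber

/-- The `ℂ`-points of `Spec B` lying over the `ℂ`-point `q` of `Spec S`. -/
def pointsOver {S : Type*} (B : Type*) [CommRing S] [CommRing B] [Algebra ℂ S] [Algebra ℂ B]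
    [Algebra S B] (q : S →ₐ[ℂ] ℂ) : Set (B →ₐ[ℂ] ℂ) :=
  {z | ∀ s, z (algebraMap S B s) = q s}

/-- Over a nonempty open subset of `Spec S`, all fibres of `Spec B → Spec S` have `d` points. -/
def HasGenericFiberCard (S B : Type*) [CommRing S] [CommRing B] [Algebra ℂ S] [Algebra ℂ B]
    [Algebra S B] (d : ℕ) : Prop :=
  ∃ P : S, P ≠ 0 ∧ ∀ q : S →ₐ[ℂ] ℂ, q P ≠ 0 → (pointsOver B q).encard = d

/-- Inverting `r` does not change the fibres over points where `r` is nonzero, so the base may be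
shrunk freely. The open set downstairs is cut out by `r` times a numerator of the polynomial
upstairs. -/
theorem HasGenericFiberCard.of_localization {S B : Type*} [CommRing S] [CommRing B] [Algebra ℂ S]
    [Algebra ℂ B] [Algebra S B] [IsScalarTower ℂ S B] [IsDomain S] {r : S} (hr : r ≠ 0) {d : ℕ}
    (h : HasGenericFiberCard (Localization.Away r)
      (Localization (Algebra.algebraMapSubmonoid B (Submonoid.powers r))) d) :
    HasGenericFiberCard S B d := by
  obtain ⟨P', hP', h⟩ := h
  obtain ⟨P, ⟨t, n, rfl⟩, hP⟩ := IsLocalization.exists_mk'_eq (Submonoid.powers r) P'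
  have hP0 : P ≠ 0 := by
    rintro rfl
    exact hP' (by rw [← hP, IsLocalization.mk'_zero])
  refine ⟨r * P, mul_ne_zero hr hP0, fun q hq => ?_⟩
  rw [map_mul] at hq
  have hqr : ∀ y : Submonoid.powers r, IsUnit (q y) := by
    rintro ⟨_, n, rfl⟩
    simpa using pow_ne_zero _ (left_ne_zero_of_mul hq)
  let q' : Localization.Away r →ₐ[ℂ] ℂ := IsLocalization.liftAlgHom (f := q) hqr
  have hq' : ∀ s, q' (algebraMap _ _ s) = q s := fun s => by simp [q']
  rw [← h q']
  · rw [← (Function.Injective.injOn _).encard_image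
      (f := fun z => z.comp (IsScalarTower.toAlgHom ℂ B _)) (s := pointsOver _ q')]
    · congr 1
      ext z
      simp only [pointsOver, Set.mem_ofPred_eq, Set.mem_image]
      constructor
      · intro hz
        have hzr : ∀ y : Algebra.algebraMapSubmonoid B (Submonoid.powers r), IsUnit (z y) := by
          rintro ⟨_, s, hs, rfl⟩
          simpa [hz] using hqr ⟨s, hs⟩
        let z' : Localization (Algebra.algebraMapSubmonoid B (Submonoid.powers r)) →ₐ[ℂ] ℂ :=
          IsLocalization.liftAlgHom (f := z) hzr
        refine ⟨z', fun s => ?_, ?_⟩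
        · have : z'.toRingHom.comp (algebraMap (Localization.Away r) _) = q'.toRingHom := by
            apply IsLocalization.ringHom_ext (Submonoid.powers r)
            ext s
            rw [RingHom.comp_apply, RingHom.comp_apply, ← IsScalarTower.algebraMap_apply,
              IsScalarTower.algebraMap_apply S B]
            simp [q', ← hz, z']
          exact DFunLike.congr_fun this s
        · ext b
          simp [z']
      · rintro ⟨z', hz', rfl⟩ s
        rw [← hq', ← hz']
        simp [← IsScalarTower.algebraMap_apply]
    · intro z w hzw
      apply IsLocalization.algHom_ext (Algebra.algebraMapSubmonoid B (Submonoid.powers r))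
      ext b
      exact DFunLike.congr_fun hzw b
  · rw [← hP, IsLocalization.liftAlgHom_apply, IsLocalization.lift_mk']
    simpa using right_ne_zero_of_mul hq

instance isScalarTower_localization_algebraMapSubmonoid {S B : Type*} [CommRing S] [CommRing B]
    [Algebra ℂ S] [Algebra ℂ B] [Algebra S B] [IsScalarTower ℂ S B] (M : Submonoid S) :
    IsScalarTower ℂ (Localization M) (Localization (Algebra.algebraMapSubmonoid B M)) :=
  .of_algebraMap_eq' <| by
    rw [IsScalarTower.algebraMap_eq ℂ S (Localization M), ← RingHom.comp_assoc,
      ← IsScalarTower.algebraMap_eq S, IsScalarTower.algebraMap_eq S B, RingHom.comp_assoc,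
      ← IsScalarTower.algebraMap_eq, ← IsScalarTower.algebraMap_eq]

/-- A finite unramified ℂ-algebra is étale, hence a product of copies of ℂ, one for each prime and
so for each point. -/
theorem card_algHom_of_formallyUnramified (F : Type*) [CommRing F] [Algebra ℂ F]
    [Module.Finite ℂ F] [Algebra.FormallyUnramified ℂ F] :
    (Set.univ : Set (F →ₐ[ℂ] ℂ)).encard = Module.finrank ℂ F := by
  have : Algebra.FormallyEtale ℂ F := Algebra.FormallyEtale.of_formallyUnramified_of_field ℂ F
  have : IsArtinianRing F := isArtinian_of_tower ℂ inferInstance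
  let e := Algebra.FormallyEtale.equivPiOfIsSepClosed ℂ F
  have : Fintype (PrimeSpectrum F) := Fintype.ofFinite _
  have h1 : Module.finrank ℂ F = Nat.card (PrimeSpectrum F) := by
    rw [e.toLinearEquiv.finrank_eq, Module.finrank_fintype_fun_eq_card, Nat.card_eq_fintype_card]
  let κ : (F →ₐ[ℂ] ℂ) → PrimeSpectrum F := fun z => ⟨RingHom.ker z, RingHom.ker_isPrime z⟩
  have hκ : Function.Bijective κ := by
    refine ⟨fun z w h => algHom_eq_of_ker_le (congrArg PrimeSpectrum.asIdeal h).le, fun p => ?_⟩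
    have : p.asIdeal.IsMaximal := IsArtinianRing.isMaximal_of_isPrime p.asIdeal
    obtain ⟨z, hz⟩ := exists_algHom_ker_eq p.asIdeal
    exact ⟨z, PrimeSpectrum.ext hz⟩
  rw [h1, Set.encard_univ, ENat.card_congr (Equiv.ofBijective κ hκ), ENat.card_eq_coe_natCard]

/-- The points over `q` are the points of the fibre ℂ ⊗ `B`, which is again unramified and whose
dimension is the rank of the free module `B`. -/
theorem encard_pointsOver_of_formallyUnramified {S B : Type*} [CommRing S] [CommRing B]
    [Algebra ℂ S] [Algebra ℂ B] [Algebra S B] [IsScalarTower ℂ S B] [Module.Finite S B]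
    [Module.Free S B] [Algebra.FormallyUnramified S B] (q : S →ₐ[ℂ] ℂ) :
    (pointsOver B q).encard = Module.finrank S B := by
  let _ : Algebra S ℂ := q.toRingHom.toAlgebra
  have hq : IsScalarTower ℂ S ℂ := .of_algebraMap_eq' q.comp_algebraMap.symm
  have : Nontrivial S := q.toRingHom.domain_nontrivial
  rw [← Module.finrank_baseChange (R := ℂ) (S := S) (M' := B),
    ← card_algHom_of_formallyUnramified (ℂ ⊗[S] B),
    ← (Function.Injective.injOn _).encard_image
      (f := fun z =>
        (Algebra.TensorProduct.includeRight (R := S) (A := ℂ) (B := B)).restrictScalars ℂ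
        |> z.comp) (s := Set.univ)]
  · congr 1
    ext z
    simp only [pointsOver, Set.mem_ofPred_eq, Set.image_univ, Set.mem_range]
    constructor
    · intro hz
      let z' : B →ₐ[S] ℂ := { z with commutes' := hz }
      refine ⟨AlgHom.liftEquiv S ℂ B ℂ z', ?_⟩
      ext b
      simp [z']
    · rintro ⟨z, rfl⟩ s
      have : (1 : ℂ) ⊗ₜ[S] algebraMap S B s = algebraMap ℂ (ℂ ⊗[S] B) (q s) := by
        rw [Algebra.algebraMap_eq_smul_one, ← TensorProduct.smul_tmul, Algebra.smul_def, mul_one]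
        rfl
      change z ((1 : ℂ) ⊗ₜ[S] algebraMap S B s) = q s
      rw [this, AlgHom.commutes]
      rfl
  · intro z w hzw
    apply Algebra.TensorProduct.ext (Subsingleton.elim _ _)
    ext b
    exact DFunLike.congr_fun hzw b

/-- A reduced Artinian ring is a product of fields, and finite field extensions in characteristic
zero are separable. -/
theorem formallyUnramified_of_isReduced (K A : Type*) [Field K] [CharZero K] [CommRing A]
    [Algebra K A] [Module.Finite K A] [IsReduced A] : Algebra.FormallyUnramified K A := by
  have : IsArtinianRing A := isArtinian_of_tower K inferInstance
  let _ (I : MaximalSpectrum A) : Field (A ⧸ I.asIdeal) := Ideal.Quotient.field I.asIdeal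
  have (I : MaximalSpectrum A) : Algebra.FormallyUnramified K (A ⧸ I.asIdeal) :=
    Algebra.FormallyUnramified.of_isSeparable K _
  exact .of_equiv ((IsArtinianRing.equivPi A).restrictScalars K).symm

/-- Each generator is killed by some element of `W`; the product kills the module. It is used to
spread the vanishing of Kähler differentials from the generic point to an open set. -/
theorem exists_smul_eq_zero_of_subsingleton {S M M' : Type*} [CommRing S] [AddCommGroup M]
    [Module S M] [AddCommGroup M'] [Module S M'] (W : Submonoid S) (g : M →ₗ[S] M')
    [IsLocalizedModule W g] [Module.Finite S M] [Subsingleton M'] :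
    ∃ r ∈ W, ∀ m : M, r • m = 0 := by
  have h := (IsLocalizedModule.subsingleton_iff W g).mp inferInstance
  choose r hrW hr using h
  obtain ⟨s, hs⟩ := Module.Finite.fg_top (R := S) (M := M)
  refine ⟨∏ m ∈ s, r m, Submonoid.prod_mem _ fun m _ => hrW m, fun m => ?_⟩
  have : (⊤ : Submodule S M) ≤ LinearMap.ker (LinearMap.lsmul S M (∏ m ∈ s, r m)) := by
    classical
    rw [← hs, Submodule.span_le]
    intro x hx
    simp only [SetLike.mem_coe, LinearMap.mem_ker, LinearMap.lsmul_apply]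
    rw [← Finset.prod_erase_mul _ _ hx, mul_smul, hr, smul_zero]
  exact this trivial

theorem finrank_localization {S B : Type*} [CommRing S] [CommRing B] [Algebra S B] [IsDomain S]
    {r : S} (hr : r ≠ 0) :
    Module.finrank (Localization.Away r)
      (Localization (Algebra.algebraMapSubmonoid B (Submonoid.powers r))) = Module.finrank S B := by
  have h := powers_le_nonZeroDivisors_of_noZeroDivisors hr
  rw [IsLocalization.finrank_eq (R := S) _ (Submonoid.powers r) h,
    IsLocalizedModule.finrank_eq (Submonoid.powers r) (IsScalarTower.toAlgHom S B
      (Localization (Algebra.algebraMapSubmonoid B (Submonoid.powers r)))).toLinearMap h]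

/-- Generic étaleness: over the fraction field of `S` the reduced algebra is unramified, so a single
nonzero `r` kills the differentials, and after inverting `r` every fibre has exactly rank-many
points. -/
theorem hasGenericFiberCard_of_free {S B : Type*} [CommRing S] [CommRing B]
    [Algebra ℂ S] [Algebra ℂ B] [Algebra S B] [IsScalarTower ℂ S B] [IsDomain S]
    [Module.Finite S B] [Module.Free S B] [IsReduced B] :
    HasGenericFiberCard S B (Module.finrank S B) := by
  let W := nonZeroDivisors S
  let K := Localization W
  let A := Localization (Algebra.algebraMapSubmonoid B W)
  have : IsFractionRing S K := inferInstanceAs (IsLocalization W K)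
  let _ : Field K := IsFractionRing.toField S
  have : CharZero S := charZero_of_injective_algebraMap (algebraMap ℂ S).injective
  have : CharZero K := charZero_of_injective_algebraMap (algebraMap ℂ K).injective
  have : Module.Finite K A := Module.Finite.of_isLocalization S B W
  have : Algebra.FormallyUnramified K A := formallyUnramified_of_isReduced K A
  have : Module.Finite S (Ω[B⁄S]) := Module.Finite.trans B _
  obtain ⟨r, hr, h⟩ := exists_smul_eq_zero_of_subsingleton W
    ((KaehlerDifferential.map S K B A).restrictScalars S)
  have hr0 : r ≠ 0 := nonZeroDivisors.ne_zero hr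
  let Sr := Localization.Away r
  let Br := Localization (Algebra.algebraMapSubmonoid B (Submonoid.powers r))
  have : Subsingleton (Ω[Br⁄Sr]) :=
    (IsLocalizedModule.subsingleton_iff (Submonoid.powers r)
      ((KaehlerDifferential.map S Sr B Br).restrictScalars S)).mpr
      fun m => ⟨r, Submonoid.mem_powers r, h m⟩
  have : Algebra.FormallyUnramified Sr Br := ⟨this⟩
  have : Module.Finite Sr Br := Module.Finite.of_isLocalization S B (Submonoid.powers r)
  have : Module.Free Sr Br := Module.free_of_isLocalizedModule (Submonoid.powers r)
    (IsScalarTower.toAlgHom S B Br).toLinearMap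
  have hfin : Module.finrank Sr Br = Module.finrank S B :=
    finrank_localization hr0
  have : Nontrivial Sr := (IsLocalization.injective Sr
    (powers_le_nonZeroDivisors_of_noZeroDivisors hr0)).nontrivial
  refine .of_localization hr0 ⟨1, one_ne_zero, fun q _ => ?_⟩
  rw [encard_pointsOver_of_formallyUnramified, hfin]

/-- Generic freeness reduces this to the free case. -/
theorem hasGenericFiberCard_of_finite {S B : Type*} [CommRing S] [CommRing B]
    [Algebra ℂ S] [Algebra ℂ B] [Algebra S B] [IsScalarTower ℂ S B] [IsDomain S]
    [IsNoetherianRing S] [Module.Finite S B] [IsReduced B] :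
    HasGenericFiberCard S B (Module.finrank S B) := by
  let W := nonZeroDivisors S
  let K := Localization W
  have : IsFractionRing S K := inferInstanceAs (IsLocalization W K)
  let _ : Field K := IsFractionRing.toField S
  have : Module.FinitePresentation S B := Module.finitePresentation_of_finite S B
  obtain ⟨r, hr, hfree, -⟩ := Module.FinitePresentation.exists_free_localizedModule_powers W
    (LocalizedModule.mkLinearMap W B) K
  have hr0 : r ≠ 0 := nonZeroDivisors.ne_zero hr
  let Sr := Localization.Away r
  let Br := Localization (Algebra.algebraMapSubmonoid B (Submonoid.powers r))
  have : Module.Finite Sr Br := Module.Finite.of_isLocalization S B (Submonoid.powers r)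
  have : Module.Free Sr Br := .of_equiv
    ((IsLocalizedModule.iso (Submonoid.powers r)
      (IsScalarTower.toAlgHom S B Br).toLinearMap).extendScalarsOfIsLocalization
        (Submonoid.powers r) Sr)
  have : IsDomain Sr := IsLocalization.isDomain_localization
    (powers_le_nonZeroDivisors_of_noZeroDivisors hr0)
  refine .of_localization hr0 ?_
  rw [← finrank_localization hr0]
  exact hasGenericFiberCard_of_free

/-- **Generic fibres of generically finite morphisms.** The number of points of the generic fibre is
the rank. -/
theorem hasGenericFiberCard_finrank {S B : Type*} [CommRing S] [CommRing B]
    [Algebra ℂ S] [Algebra ℂ B] [Algebra S B] [IsScalarTower ℂ S B] [IsDomain S]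
    [IsNoetherianRing S] [IsReduced B] (T : Finset B) (hT : Algebra.adjoin S (T : Set B) = ⊤)
    (halg : ∀ t ∈ T, IsAlgebraic S t) :
    HasGenericFiberCard S B (Module.finrank S B) := by
  -- Each generator becomes integral after multiplication by some nonzero `c t`, so inverting the
  -- product of the `c t` makes the algebra finite.
  have h : ∀ t : T, ∃ c : S, c ≠ 0 ∧ IsIntegral S (c • (t : B)) := fun t =>
    (halg t t.2).exists_integral_multiple
  choose c hc0 hc using h
  let r := ∏ t, c t
  have hr0 : r ≠ 0 := Finset.prod_ne_zero_iff.mpr fun t _ => hc0 t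
  let Sr := Localization.Away r
  let Br := Localization (Algebra.algebraMapSubmonoid B (Submonoid.powers r))
  have hint : ∀ t ∈ algebraMap B Br '' T, IsIntegral Sr t := by
    rintro _ ⟨t, ht, rfl⟩
    have hu : IsUnit (algebraMap S Sr (c ⟨t, ht⟩)) :=
      isUnit_of_dvd_unit (map_dvd _ (Finset.dvd_prod_of_mem c (Finset.mem_univ _)))
        (IsLocalization.Away.algebraMap_isUnit (S := Sr) r)
    obtain ⟨u, hu⟩ := hu.exists_left_inv
    have h1 : IsIntegral Sr (algebraMap B Br (c ⟨t, ht⟩ • t)) :=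
      ((hc ⟨t, ht⟩).map (IsScalarTower.toAlgHom S B Br)).tower_top
    have h2 : algebraMap B Br t = u • algebraMap B Br (c ⟨t, ht⟩ • t) := by
      rw [← IsScalarTower.coe_toAlgHom' S, map_smul, ← algebraMap_smul Sr (c ⟨t, ht⟩),
        smul_smul, hu, one_smul]
    rw [h2]
    exact h1.smul u
  have htop : Algebra.adjoin Sr (algebraMap B Br '' T) = ⊤ := by
    rw [eq_top_iff]
    rintro x -
    obtain ⟨b, ⟨_, s, hs, rfl⟩, rfl⟩ := IsLocalization.exists_mk'_eq
      (Algebra.algebraMapSubmonoid B (Submonoid.powers r)) x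
    have hb : algebraMap B Br b ∈ Algebra.adjoin Sr (algebraMap B Br '' T) := by
      have : (⊤ : Subalgebra S B) ≤
          ((Algebra.adjoin Sr (algebraMap B Br '' T)).restrictScalars S).comap
          (IsScalarTower.toAlgHom S B Br) := by
        rw [← hT, Algebra.adjoin_le_iff]
        exact fun t ht => Algebra.subset_adjoin ⟨t, ht, rfl⟩
      exact this trivial
    have : IsLocalization.mk' (M := Algebra.algebraMapSubmonoid B (Submonoid.powers r)) Br b 
        ⟨algebraMap S B s, Submonoid.mem_map_of_mem _ hs⟩ =
          IsLocalization.mk' Sr 1 ⟨s, hs⟩ • algebraMap B Br b := by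
      rw [IsLocalization.mk'_eq_iff_eq_mul, ← IsScalarTower.algebraMap_apply,
        IsScalarTower.algebraMap_apply S Sr Br, Algebra.smul_def, mul_right_comm, ← map_mul,
        IsLocalization.mk'_spec]
      simp
    rw [this]
    exact Subalgebra.smul_mem _ hb _
  have : Module.Finite Sr Br := by
    refine ⟨?_⟩
    rw [← Algebra.top_toSubmodule, ← htop]
    exact fg_adjoin_of_finite (T.finite_toSet.image _) hint
  have : IsDomain Sr := IsLocalization.isDomain_localization
    (powers_le_nonZeroDivisors_of_noZeroDivisors hr0)
  refine .of_localization hr0 ?_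
  rw [← finrank_localization hr0]
  exact hasGenericFiberCard_of_finite

end GenericFiber

/-! ### Bounded functions are integral: the case of a polynomial base -/

section Integrality

open Polynomial in
/-- A form of **Chevalley's theorem** for `ℂ`-points. -/
theorem exists_forall_algHom_extends {A D : Type*} [CommRing A] [CommRing D] [IsDomain D]
    [Algebra ℂ A] [Algebra ℂ D] [Algebra.FiniteType ℂ A] [Algebra.FiniteType ℂ D] (f : A →ₐ[ℂ] D) :
    ∃ h : A, f h ≠ 0 ∧ ∀ w : A →ₐ[ℂ] ℂ, RingHom.ker f ≤ RingHom.ker w → w h ≠ 0 →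
      ∃ z : D →ₐ[ℂ] ℂ, z.comp f = w := by
  have : IsNoetherianRing A := Algebra.FiniteType.isNoetherianRing ℂ A
  have hf : f.toRingHom.FinitePresentation := by
    refine RingHom.FinitePresentation.of_finiteType.mp (RingHom.FiniteType.of_comp_finiteType
      (f := algebraMap ℂ A) ?_)
    rw [AlgHom.toRingHom_eq_coe, AlgHom.comp_algebraMap]
    exact RingHom.finiteType_algebraMap.mpr inferInstance
  obtain ⟨s, hs⟩ := PrimeSpectrum.exists_constructibleSetData_iff.mpr
    (PrimeSpectrum.isConstructible_range_comap hf)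
  -- The image of the generic point of `D` lies in one of the locally closed pieces of the
  -- constructible image. The equations of that piece vanish on the closure of the image, and its
  -- one inequation supplies `h`.
  have hbot : PrimeSpectrum.comap f.toRingHom ⊥ ∈ s.toSet := hs ▸ ⟨_, rfl⟩
  simp only [PrimeSpectrum.ConstructibleSetData.toSet, Set.mem_iUnion] at hbot
  obtain ⟨c, hc, hcg, hcf⟩ := hbot
  refine ⟨c.f, fun h => hcf ?_, fun w hw hwh => ?_⟩
  · rw [PrimeSpectrum.mem_zeroLocus, Set.singleton_subset_iff]
    exact h
  have hwmem : (⟨RingHom.ker w, RingHom.ker_isPrime w⟩ : PrimeSpectrum A) ∈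
      Set.range (PrimeSpectrum.comap f.toRingHom) := by
    rw [← hs]
    simp only [PrimeSpectrum.ConstructibleSetData.toSet, Set.mem_iUnion]
    refine ⟨c, hc, fun x hx => hw (hcg hx), fun h => hwh ?_⟩
    exact h rfl
  obtain ⟨Q, hQ⟩ := hwmem
  have hQ' : Q.asIdeal.comap f.toRingHom = RingHom.ker w := congrArg PrimeSpectrum.asIdeal hQ
  obtain ⟨m, hm, hQm⟩ := Q.asIdeal.exists_le_maximal Q.2.ne_top
  obtain ⟨z, rfl⟩ := exists_algHom_ker_eq m
  refine ⟨z, (algHom_eq_of_ker_le ?_).symm⟩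
  rw [← hQ']
  exact fun x hx => hQm hx

/-- On the complex line joining any point to one where `f` is nonzero, `f` has only finitely many
zeros. -/
theorem dense_eval_ne_zero {σ : Type*} [Finite σ] {f : MvPolynomial σ ℂ} (hf : f ≠ 0) :
    Dense {v : σ → ℂ | MvPolynomial.eval v f ≠ 0} := by
  intro v
  obtain ⟨w, hw⟩ : ∃ w, MvPolynomial.eval w f ≠ 0 := by
    by_contra! h
    exact hf (MvPolynomial.funext fun v => by simpa using h v)
  let p : Polynomial ℂ := MvPolynomial.aeval (fun i => .C (v i) + .X * .C (w i - v i)) f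
  have hp : ∀ t, p.eval t = MvPolynomial.eval (fun i => v i + t * (w i - v i)) f := by
    intro t
    have := MvPolynomial.comp_aeval_apply (fun i => .C (v i) + .X * .C (w i - v i))
      (Polynomial.aeval (R := ℂ) t) f
    simpa [p, MvPolynomial.aeval_eq_eval] using this
  have hp0 : p ≠ 0 := by
    intro h
    apply hw
    have := hp 1
    rw [h] at this
    simpa using this.symm
  have hfin : {t | p.eval t = 0}.Finite := by
    refine (p.roots.toFinset.finite_toSet).subset fun t ht => ?_
    simpa [hp0] using ht
  have hd : Dense {t | p.eval t = 0}ᶜ := hfin.countable.dense_compl ℂ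
  have hc : Continuous fun t : ℂ => fun i => v i + t * (w i - v i) := by fun_prop
  have := map_mem_closure hc (hd 0) (t := {v : σ → ℂ | MvPolynomial.eval v f ≠ 0})
    fun t ht => by simpa [hp] using ht
  simpa using this

theorem exists_norm_eval_le {σ : Type*} [Fintype σ] (f : MvPolynomial σ ℂ) (r : ℝ) :
    ∃ C, ∀ v : σ → ℂ, (∀ i, ‖v i‖ ≤ r) → ‖MvPolynomial.eval v f‖ ≤ C := by
  have hK : IsCompact (Set.univ.pi fun _ : σ => Metric.closedBall (0 : ℂ) r) :=
    isCompact_univ_pi fun _ => isCompact_closedBall _ _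
  obtain ⟨C, hC⟩ := hK.exists_bound_of_continuousOn (MvPolynomial.continuous_eval f).continuousOn
  exact ⟨C, fun v hv => hC v (by simpa using hv)⟩

/-- The roots of a polynomial whose lower coefficients are bounded in terms of the leading one are
bounded. -/
theorem norm_le_of_monic_of_isRoot {p : Polynomial ℂ} (hp : p.Monic) {x : ℂ} (hx : p.IsRoot x) :
    ‖x‖ ≤ 1 + ∑ i ∈ Finset.range p.natDegree, ‖p.coeff i‖ := by
  have h : ‖x‖ ≤ Polynomial.cauchyBound p := by
    exact_mod_cast (hx.norm_lt_cauchyBound hp.ne_zero).le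
  refine h.trans ?_
  rw [Polynomial.cauchyBound, hp.leadingCoeff]
  simp only [nnnorm_one, div_one, NNReal.coe_add, NNReal.coe_one]
  rw [add_comm]
  gcongr
  have : (Finset.range p.natDegree).sup (fun i => ‖p.coeff i‖₊) ≤
      ∑ i ∈ Finset.range p.natDegree, ‖p.coeff i‖₊ :=
    Finset.sup_le fun i hi => Finset.single_le_sum (f := fun i => ‖p.coeff i‖₊) (by simp) hi
  have h2 := NNReal.coe_le_coe.mpr this
  simpa using h2

/-- Vieta's formulas, with the leading coefficient kept on the right so that the inequality survives
a limit in which that coefficient tends to zero. -/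
theorem norm_coeff_le_of_roots_le (n : ℕ) (C : ℝ) :
    ∃ M : ℝ, ∀ p : Polynomial ℂ, p.natDegree = n → (∀ x, p.IsRoot x → ‖x‖ ≤ C) →
      ∀ i, ‖p.coeff i‖ ≤ M * ‖p.leadingCoeff‖ := by
  refine ⟨max C 1 ^ n * 2 ^ n, fun p hn hx i => ?_⟩
  by_cases hp : p = 0
  · simp [hp]
  have hl : p.leadingCoeff ≠ 0 := by simpa using hp
  let r : Polynomial ℂ := p * .C p.leadingCoeff⁻¹
  have hr : r.Monic := Polynomial.monic_mul_leadingCoeff_inv hp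
  have hrn : r.natDegree = n := by
    rw [← hn]
    exact Polynomial.natDegree_mul_C (inv_ne_zero hl)
  have h := Polynomial.coeff_le_of_roots_le (f := RingHom.id ℂ) (B := max C 1) i hr
    (IsAlgClosed.splits _) (fun z hz => by
      rw [Polynomial.map_id, Polynomial.mem_roots hr.ne_zero] at hz
      refine (hx z ?_).trans (le_max_left _ _)
      simpa [r, Polynomial.IsRoot, hl, hp] using hz)
  rw [Polynomial.map_id, hrn] at h
  have h2 : ‖r.coeff i‖ ≤ max C 1 ^ n * 2 ^ n := by
    refine h.trans ?_
    gcongr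
    · exact le_max_right _ _
    · omega
    · exact_mod_cast Nat.choose_le_two_pow n i
  have h3 : p.coeff i = r.coeff i * p.leadingCoeff := by
    simp [r, Polynomial.coeff_mul_C, hp]
  rw [h3, norm_mul]
  gcongr

open Polynomial in
-- Gauss's lemma: over the fraction field `g` stays irreducible, so a polynomial with root `u` that
-- it does not divide would be coprime to it, which is absurd at `u`. Primitivity brings
-- divisibility back to `S`.
theorem dvd_of_aeval_eq_zero {S D : Type*} [CommRing S] [IsDomain S] [UniqueFactorizationMonoid S]
    [CommRing D] [IsDomain D] [Algebra S D] (hinj : Function.Injective (algebraMap S D))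
    {u : D} {g p : S[X]} (hg : Prime g) (hdeg : g.natDegree ≠ 0) (hgu : aeval u g = 0)
    (hpu : aeval u p = 0) : g ∣ p := by
  have : FaithfulSMul S D := (faithfulSMul_iff_algebraMap_injective S D).mpr hinj
  have hprim : g.IsPrimitive := hg.irreducible.isPrimitive hdeg
  let _ : NormalizedGCDMonoid S := Classical.choice inferInstance
  let _ : Algebra (FractionRing S) (FractionRing D) := FractionRing.liftAlgebra S _
  have hmap : ∀ p : S[X], aeval u p = 0 →
      aeval (algebraMap D (FractionRing D) u) (p.map (algebraMap S (FractionRing S))) = 0 := by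
    intro p hp
    rw [aeval_map_algebraMap, aeval_algebraMap_apply, hp, map_zero]
  have hirr : Irreducible (g.map (algebraMap S (FractionRing S))) :=
    hprim.irreducible_iff_irreducible_map_fraction_map.mp hg.irreducible
  refine hprim.dvd_of_fraction_map_dvd_fraction_map (K := FractionRing S) ?_
  by_contra hdvd
  obtain ⟨a, b, hab⟩ := (EuclideanDomain.dvd_or_coprime _ _ hirr).resolve_left hdvd
  have := congrArg (aeval (algebraMap D (FractionRing D) u)) hab
  simp [hmap g hgu, hmap p hpu] at this

open Polynomial in
-- Boundedness first forces `u` to be algebraic, with an irreducible primitive equation g. Suppose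
-- an irreducible π divides its leading coefficient. Near a zero of π the roots of g are values of
-- `u`, hence bounded, so all coefficients of g are dominated by the leading one and vanish on {π =
-- 0}. By the Nullstellensatz π divides them all, contradicting primitivity. So the leading
-- coefficient is a unit.
theorem isIntegral_of_bounded_of_injective {σ : Type*} [Fintype σ] {D : Type*} [CommRing D]
    [IsDomain D] [Algebra ℂ D] [Algebra.FiniteType ℂ D] [Algebra (MvPolynomial σ ℂ) D]
    [IsScalarTower ℂ (MvPolynomial σ ℂ) D]
    (hinj : Function.Injective (algebraMap (MvPolynomial σ ℂ) D)) (u : D)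
    (hb : ∀ r : ℝ, ∃ C : ℝ, ∀ z : D →ₐ[ℂ] ℂ,
      (∀ i, ‖z (algebraMap (MvPolynomial σ ℂ) D (.X i))‖ ≤ r) → ‖z u‖ ≤ C) :
    IsIntegral (MvPolynomial σ ℂ) u := by
  let S := MvPolynomial σ ℂ
  have : FaithfulSMul S D := (faithfulSMul_iff_algebraMap_injective S D).mpr hinj
  let f : S[X] →ₐ[ℂ] D := (aeval u : S[X] →ₐ[S] D).restrictScalars ℂ
  have hfC : ∀ a : S, f (C a) = algebraMap S D a := fun a => aeval_C _ _
  obtain ⟨h, hh0, hh⟩ := exists_forall_algHom_extends f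
  let w (v : σ → ℂ) (t : ℂ) : S[X] →ₐ[ℂ] ℂ :=
    (aeval t).comp (mapAlgHom (MvPolynomial.aeval v))
  have hw : ∀ v t p, w v t p = (p.map (MvPolynomial.eval v)).eval t := by
    intro v t p
    rw [← coe_aeval_eq_eval]
    rfl
  have hwC : ∀ v t a, w v t (C a) = MvPolynomial.eval v a := by simp [hw]
  have hbw : ∀ r : ℝ, ∃ B : ℝ, ∀ v t, (∀ i, ‖v i‖ ≤ r) → RingHom.ker f ≤ RingHom.ker (w v t) →
      w v t h ≠ 0 → ‖t‖ ≤ B := by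
    intro r
    obtain ⟨B, hB⟩ := hb r
    refine ⟨B, fun v t hv hk hwh => ?_⟩
    obtain ⟨z, hz⟩ := hh (w v t) hk hwh
    have h1 : z u = t := by
      have := DFunLike.congr_fun hz X
      rw [hw] at this
      simpa [f] using this
    rw [← h1]
    refine hB z fun i => ?_
    have := DFunLike.congr_fun hz (C (.X i))
    rw [hwC, AlgHom.comp_apply, hfC] at this
    rw [this]
    simpa using hv i
  have hkC : ∀ a : S, f (C a) = 0 → a = 0 := fun a ha =>
    (map_eq_zero_iff _ hinj).mp ((hfC a).symm.trans ha)
  -- If `u` were transcendental, almost every `t` over a suitable fixed `v` would be a value of `u`,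
  -- so the values could not be bounded.
  have hualg : IsAlgebraic S u := by
    by_contra htr
    have hker : RingHom.ker f = ⊥ := by
      rw [eq_bot_iff]
      intro p hp
      by_contra hp0
      exact htr ⟨p, hp0, hp⟩
    have hne : h ≠ 0 := by
      rintro rfl
      exact hh0 (map_zero f)
    obtain ⟨i, hi⟩ : ∃ i, h.coeff i ≠ 0 := by
      by_contra! hall
      exact hne (ext hall)
    obtain ⟨v, hv⟩ := (dense_eval_ne_zero hi).nonempty
    have hv0 : h.map (MvPolynomial.eval v) ≠ 0 := by
      intro h0
      have := congrArg (coeff · i) h0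
      simp only [coeff_map, coeff_zero] at this
      exact hv this
    obtain ⟨B, hB⟩ := hbw (∑ i, ‖v i‖)
    have hfin : {t | (h.map (MvPolynomial.eval v)).eval t = 0}.Finite := by
      refine (h.map (MvPolynomial.eval v)).roots.toFinset.finite_toSet.subset fun t ht => ?_
      simpa [hv0] using ht
    obtain ⟨t, ht, htB⟩ := (hfin.countable.dense_compl ℂ).exists_mem_open
      (isOpen_lt continuous_const continuous_norm : IsOpen {t : ℂ | B < ‖t‖})
      ⟨((|B| + 1 : ℝ) : ℂ), by
        have := le_abs_self B
        simp only [Set.mem_ofPred_eq, Complex.norm_real, Real.norm_eq_abs]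
        rw [abs_of_pos (by positivity)]
        linarith⟩
    refine absurd (hB v t (fun i => Finset.single_le_sum (f := fun i => ‖v i‖)
      (fun _ _ => norm_nonneg _) (Finset.mem_univ i)) (hker ▸ bot_le) ?_) (not_le.mpr htB)
    rw [hw]
    exact ht
  have hprime : (RingHom.ker f).IsPrime := RingHom.ker_isPrime f
  obtain ⟨g, hgf, hg⟩ := hprime.exists_mem_prime_of_ne_bot (by
    obtain ⟨p, hp0, hp⟩ := hualg
    exact fun hbot => hp0 (by
      have : p ∈ RingHom.ker f := hp
      rwa [hbot] at this))
  have hgdeg : g.natDegree ≠ 0 := by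
    intro h0
    rw [eq_C_of_natDegree_eq_zero h0] at hgf hg
    exact hg.ne_zero (by rw [hkC _ hgf, C_0])
  have hgprim : g.IsPrimitive := hg.irreducible.isPrimitive hgdeg
  have hker : ∀ p, f p = 0 → g ∣ p := fun p hp =>
    dvd_of_aeval_eq_zero hinj hg hgdeg hgf hp
  have hker' : ∀ v t, (g.map (MvPolynomial.eval v)).IsRoot t →
      RingHom.ker f ≤ RingHom.ker (w v t) := by
    intro v t ht p hp
    obtain ⟨e, rfl⟩ := hker p hp
    have : w v t g = 0 := by rw [hw]; exact ht
    rw [RingHom.mem_ker, map_mul, this, zero_mul]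
  have hhalg : IsAlgebraic S (f h) := by
    have : Algebra.adjoin S {u} ≤ Subalgebra.algebraicClosure S D := by
      rw [Algebra.adjoin_le_iff, Set.singleton_subset_iff]
      exact hualg
    exact this (aeval_mem_adjoin_singleton S u)
  -- The relation for `f h` has nonzero constant term e₀. Hence `h` cannot vanish at a root over `v`
  -- when e₀(v) ≠ 0, so Chevalley's exceptional set is avoided generically in `v`.
  obtain ⟨e, he0, he⟩ := hhalg.exists_nonzero_coeff_and_aeval_eq_zero
    (mem_nonZeroDivisors_of_ne_zero hh0)
  have hgen : ∀ v t, (g.map (MvPolynomial.eval v)).IsRoot t →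
      MvPolynomial.eval v (e.coeff 0) ≠ 0 → w v t h ≠ 0 := by
    intro v t ht hv hwh
    apply hv
    have h1 : e.divX.aeval h * h + C (e.coeff 0) ∈ RingHom.ker f := by
      have h2 := he
      rw [← divX_mul_X_add e] at h2
      rw [RingHom.mem_ker, map_add, map_mul, hfC]
      have h3 : f (e.divX.aeval h) = e.divX.aeval (f h) :=
        (aeval_algHom_apply (aeval u : S[X] →ₐ[S] D) h e.divX).symm
      rw [h3]
      simpa using h2
    have h2 := hker' v t ht h1
    rw [RingHom.mem_ker, map_add, map_mul, hwh, mul_zero, zero_add, hwC] at h2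
    exact h2
  have hunit : IsUnit g.leadingCoeff := by
    by_contra hnu
    obtain ⟨π, hπ, hπg⟩ := WfDvdMonoid.exists_irreducible_factor hnu
      (leadingCoeff_ne_zero.mpr hg.ne_zero)
    refine hπ.not_isUnit (hgprim π (C_dvd_iff_dvd_coeff _ _ |>.mpr fun i => ?_))
    have hprime : (Ideal.span {π}).IsPrime := (Ideal.span_singleton_prime hπ.ne_zero).mpr hπ.prime
    rw [← Ideal.mem_span_singleton, ← MvPolynomial.IsPrime.vanishingIdeal_zeroLocus (K := ℂ)
      (Ideal.span {π})]
    intro v hv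
    have hv0 : MvPolynomial.eval v g.leadingCoeff = 0 := by
      obtain ⟨a, ha⟩ := hπg
      have := hv π (Ideal.mem_span_singleton_self π)
      rw [MvPolynomial.aeval_eq_eval] at this
      rw [ha, map_mul]
      exact mul_eq_zero_of_left this _
    rw [MvPolynomial.aeval_eq_eval]
    -- This radius covers the unit ball around `v`.
    obtain ⟨B, hB⟩ := hbw (∑ i, ‖v i‖ + 1)
    obtain ⟨M, hM⟩ := norm_coeff_le_of_roots_le g.natDegree B
    -- The inequality is known only at generic points of the ball. Adjoining the complement of the
    -- open ball gives a closed set containing a dense one, so the inequality reaches the centre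
    -- `v`.
    have hclosed : IsClosed ({x : σ → ℂ | ‖MvPolynomial.eval x (g.coeff i)‖ ≤
        M * ‖MvPolynomial.eval x g.leadingCoeff‖} ∪ (Metric.ball v 1)ᶜ) := by
      refine IsClosed.union (isClosed_le ?_ ?_) Metric.isOpen_ball.isClosed_compl
      · exact (MvPolynomial.continuous_eval _).norm
      · exact continuous_const.mul (MvPolynomial.continuous_eval _).norm
    have hsub := hclosed.closure_subset_iff.mpr (show {x : σ → ℂ |
        MvPolynomial.eval x (g.leadingCoeff * e.coeff 0) ≠ 0} ⊆ _ by
      intro x hx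
      simp only [Set.mem_ofPred_eq, map_mul, mul_ne_zero_iff] at hx
      by_cases hxv : x ∈ Metric.ball v 1
      · left
        have hlead : (g.map (MvPolynomial.eval x)).leadingCoeff =
            MvPolynomial.eval x g.leadingCoeff := leadingCoeff_map_of_leadingCoeff_ne_zero _ hx.1
        have := hM (g.map (MvPolynomial.eval x))
          (natDegree_map_of_leadingCoeff_ne_zero _ hx.1) (fun t ht => by
            refine hB x t (fun i => ?_) (hker' x t ht) (hgen x t ht hx.2)
            have h1 : ‖x i - v i‖ ≤ 1 := by
              rw [← dist_eq_norm]
              exact (dist_le_pi_dist x v i).trans (Metric.mem_ball.mp hxv).le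
            have h2 : ‖v i‖ ≤ ∑ i, ‖v i‖ := Finset.single_le_sum (f := fun i => ‖v i‖)
              (fun _ _ => norm_nonneg _) (Finset.mem_univ i)
            have h3 : ‖x i‖ ≤ ‖v i‖ + ‖x i - v i‖ := norm_le_norm_add_norm_sub' _ _
            linarith) i
        rwa [hlead, coeff_map] at this
      · exact Or.inr hxv)
    have hmem := hsub (dense_eval_ne_zero (mul_ne_zero (leadingCoeff_ne_zero.mpr hg.ne_zero) he0) v)
    rcases hmem with hmem | hmem
    · simp only [Set.mem_ofPred_eq, hv0, norm_zero, mul_zero] at hmem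
      simpa using hmem
    · exact absurd (Metric.mem_ball_self one_pos) hmem
  obtain ⟨a, ha⟩ := hunit.exists_left_inv
  refine ⟨C a * g, monic_C_mul_of_mul_leadingCoeff_eq_one ha, ?_⟩
  rw [← aeval_def, map_mul]
  exact mul_eq_zero_of_right _ hgf

end Integrality

/-! ### Bounded functions are integral: the general case -/

section Bounded

/-- The easy converse: a monic equation with bounded coefficients has bounded roots. -/
theorem exists_norm_le_of_isIntegral {σ : Type*} [Fintype σ] {D : Type*} [CommRing D] [Algebra ℂ D]
    [Algebra (MvPolynomial σ ℂ) D] [IsScalarTower ℂ (MvPolynomial σ ℂ) D] {x : D}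
    (hx : IsIntegral (MvPolynomial σ ℂ) x) (r : ℝ) : ∃ C : ℝ, ∀ z : D →ₐ[ℂ] ℂ,
      (∀ i, ‖z (algebraMap (MvPolynomial σ ℂ) D (.X i))‖ ≤ r) → ‖z x‖ ≤ C := by
  obtain ⟨p, hp, hpx⟩ := hx
  choose C hC using fun i => exists_norm_eval_le (p.coeff i) r
  refine ⟨1 + ∑ i ∈ Finset.range p.natDegree, C i, fun z hz => ?_⟩
  let v : σ → ℂ := fun i => z (algebraMap (MvPolynomial σ ℂ) D (.X i))
  have hzv : z.toRingHom.comp (algebraMap (MvPolynomial σ ℂ) D) = MvPolynomial.eval v := by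
    apply MvPolynomial.ringHom_ext
    · intro a
      have := z.commutes a
      rw [IsScalarTower.algebraMap_apply ℂ (MvPolynomial σ ℂ) D] at this
      simpa using this
    · intro i
      simp [v]
  have hroot : (p.map (MvPolynomial.eval v)).IsRoot (z x) := by
    rw [Polynomial.IsRoot, Polynomial.eval_map, ← hzv]
    have := congrArg z.toRingHom hpx
    rwa [Polynomial.hom_eval₂, map_zero] at this
  refine (norm_le_of_monic_of_isRoot (hp.map _) hroot).trans ?_
  rw [hp.natDegree_map]
  gcongr with i hi
  rw [Polynomial.coeff_map]
  exact hC i v hz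

/-- Noether normalization of the algebra generated by `g` supplies a polynomial base. The `g i` are
integral over it, so bounds on the new variables bound the `g i`, and hence `u`. -/
theorem isIntegral_of_bounded_of_isDomain {ι D : Type*} [Finite ι] [CommRing D] [IsDomain D]
    [Algebra ℂ D] [Algebra.FiniteType ℂ D] (g : ι → D) (u : D)
    (hb : ∀ r : ℝ, ∃ C : ℝ, ∀ z : D →ₐ[ℂ] ℂ, (∀ i, ‖z (g i)‖ ≤ r) → ‖z u‖ ≤ C) :
    IsIntegral (Algebra.adjoin ℂ (Set.range g)) u := by
  have := Fintype.ofFinite ι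
  let A := Algebra.adjoin ℂ (Set.range g)
  have : Algebra.FiniteType ℂ A := Subalgebra.fg_iff_finiteType _ |>.mp
    (Subalgebra.fg_def.mpr ⟨_, Set.finite_range g, rfl⟩)
  obtain ⟨s, φ, hφ, hint⟩ := exists_integral_inj_algHom_of_fg ℂ A
  let _ : Algebra (MvPolynomial (Fin s) ℂ) A := φ.toRingHom.toAlgebra
  let _ : Algebra (MvPolynomial (Fin s) ℂ) D := (A.val.comp φ).toRingHom.toAlgebra
  have : IsScalarTower (MvPolynomial (Fin s) ℂ) A D := .of_algebraMap_eq' rfl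
  have : IsScalarTower ℂ (MvPolynomial (Fin s) ℂ) D :=
    .of_algebraMap_eq' (A.val.comp φ).comp_algebraMap.symm
  have key : IsIntegral (MvPolynomial (Fin s) ℂ) u := by
    refine isIntegral_of_bounded_of_injective (Subtype.val_injective.comp hφ) u fun r => ?_
    have h1 : ∀ i, ∃ C : ℝ, ∀ z : D →ₐ[ℂ] ℂ,
        (∀ i, ‖z (algebraMap (MvPolynomial (Fin s) ℂ) D (.X i))‖ ≤ r) → ‖z (g i)‖ ≤ C := fun i =>
      exists_norm_le_of_isIntegral (σ := Fin s) (x := g i)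
        (IsIntegral.algebraMap (A := A) (B := D)
          (x := ⟨g i, Algebra.subset_adjoin ⟨i, rfl⟩⟩) (hint _)) r
    choose C hC using h1
    obtain ⟨B, hB⟩ := hb (∑ i, |C i|)
    refine ⟨B, fun z hz => hB z fun i => ((hC i z hz).trans (le_abs_self _)).trans ?_⟩
    exact Finset.single_le_sum (f := fun i => |C i|) (fun _ _ => abs_nonneg _) (Finset.mem_univ i)
  exact key.tower_top

/-- Lift a monic equation from each of the finitely many irreducible components. The product of the
lifts vanishes at `u` modulo nilpotents, and a power of it vanishes outright. -/
theorem isIntegral_of_forall_minimalPrimes {k B : Type*} [CommRing k] [CommRing B] [Algebra k B]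
    [IsNoetherianRing B] (A : Subalgebra k B) (u : B)
    (h : ∀ q ∈ minimalPrimes B,
      IsIntegral (A.map (Ideal.Quotient.mkₐ k q)) (Ideal.Quotient.mkₐ k q u)) :
    IsIntegral A u := by
  have h1 : ∀ q ∈ minimalPrimes B, ∃ p : Polynomial A, p.Monic ∧ p.aeval u ∈ q := by
    intro q hq
    let π := Ideal.Quotient.mkₐ k q
    obtain ⟨p, hp, hpu⟩ := h q hq
    let ρ : A →+* A.map π := ((π.comp A.val).codRestrict (A.map π) fun a =>
      Subalgebra.mem_map.mpr ⟨a, a.2, rfl⟩).toRingHom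
    have hρ : Function.Surjective ρ := by
      rintro ⟨_, a, ha, rfl⟩
      exact ⟨⟨a, ha⟩, rfl⟩
    obtain ⟨p, rfl, -, hp'⟩ := Polynomial.lifts_and_natDegree_eq_and_monic
      ((Polynomial.lifts_iff_coeff_lifts p).mpr fun n => hρ _) hp
    refine ⟨p, hp', ?_⟩
    rw [Polynomial.eval₂_map] at hpu
    rw [← Ideal.Quotient.eq_zero_iff_mem, Polynomial.aeval_def, Polynomial.hom_eval₂]
    exact hpu
  choose! p hp hpu using h1
  have hfin : (minimalPrimes B).Finite := minimalPrimes.finite_of_isNoetherianRing B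
  let P := ∏ q ∈ hfin.toFinset, p q
  have hP : P.Monic := Polynomial.monic_prod_of_monic _ _ fun q hq => hp q (hfin.mem_toFinset.mp hq)
  have hnil : P.aeval u ∈ nilradical B := by
    rw [nilradical, ← Ideal.sInf_minimalPrimes, Submodule.mem_sInf]
    intro q hq
    exact Ideal.mem_of_dvd q (map_dvd _ (Finset.dvd_prod_of_mem p (hfin.mem_toFinset.mpr hq)))
      (hpu q hq)
  obtain ⟨n, hn⟩ := hnil
  exact ⟨P ^ n, hP.pow n, by rw [← Polynomial.aeval_def, map_pow, hn]⟩

/-- A regular function that is bounded wherever the functions `g i` are bounded is integral over the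
algebra they generate. -/
theorem isIntegral_of_bounded {ι B : Type*} [Finite ι] [CommRing B]
    [Algebra ℂ B] [Algebra.FiniteType ℂ B] (g : ι → B) (u : B)
    (hb : ∀ r : ℝ, ∃ C : ℝ, ∀ z : B →ₐ[ℂ] ℂ, (∀ i, ‖z (g i)‖ ≤ r) → ‖z u‖ ≤ C) :
    IsIntegral (Algebra.adjoin ℂ (Set.range g)) u := by
  have : IsNoetherianRing B := Algebra.FiniteType.isNoetherianRing ℂ B
  refine isIntegral_of_forall_minimalPrimes _ _ fun q hq => ?_
  have : q.IsPrime := hq.1.1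
  rw [AlgHom.map_adjoin, ← Set.range_comp]
  refine isIntegral_of_bounded_of_isDomain _ _ fun r => ?_
  obtain ⟨C, hC⟩ := hb r
  exact ⟨C, fun z hz => hC (z.comp (Ideal.Quotient.mkₐ ℂ q)) hz⟩

end Bounded

/-! ### Growth of the degree filtration and the rank -/

section Hilbert

/-- The span of `1` and of the family `x`. Its powers filter the algebra generated by `x` by
degree. -/
noncomputable def affineSpan {σ R : Type*} [CommRing R] [Algebra ℂ R] (x : σ → R) :
    Submodule ℂ R :=
  Submodule.span ℂ (insert 1 (Set.range x))

section

variable {σ R : Type*} [CommRing R] [Algebra ℂ R] (x : σ → R)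

theorem one_mem_affineSpan : 1 ∈ affineSpan x :=
  Submodule.subset_span (Set.mem_insert _ _)

theorem mem_affineSpan (i : σ) : x i ∈ affineSpan x :=
  Submodule.subset_span (Set.mem_insert_of_mem _ ⟨i, rfl⟩)

theorem affineSpan_le {V : Submodule ℂ R} (h1 : 1 ∈ V) (h : ∀ i, x i ∈ V) : affineSpan x ≤ V := by
  rw [affineSpan, Submodule.span_le, Set.insert_subset_iff]
  exact ⟨h1, by rintro _ ⟨i, rfl⟩; exact h i⟩

theorem fg_affineSpan [Finite σ] : (affineSpan x).FG :=
  Submodule.fg_span ((Set.finite_range x).insert 1)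

theorem map_affineSpan {R' : Type*} [CommRing R'] [Algebra ℂ R'] (f : R →ₐ[ℂ] R') :
    (affineSpan x).map f.toLinearMap = affineSpan fun i => f (x i) := by
  rw [affineSpan, Submodule.map_span, Set.image_insert_eq, ← Set.range_comp]
  simp only [AlgHom.toLinearMap_apply, map_one]
  rfl

theorem map_pow_affineSpan {R' : Type*} [CommRing R'] [Algebra ℂ R'] (f : R →ₐ[ℂ] R') (s : ℕ) :
    (affineSpan x ^ s).map f.toLinearMap = (affineSpan fun i => f (x i)) ^ s := by
  rw [Submodule.map_pow, map_affineSpan]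

end

theorem pow_mono_of_one_mem {R : Type*} [CommRing R] [Algebra ℂ R] {V : Submodule ℂ R}
    (h1 : 1 ∈ V) {s t : ℕ} (h : s ≤ t) : V ^ s ≤ V ^ t :=
  pow_le_pow_right' (Submodule.one_le.mpr h1) h

theorem exists_mem_pow_affineSpan {σ R : Type*} [CommRing R] [Algebra ℂ R] {x : σ → R}
    (hx : Algebra.adjoin ℂ (Set.range x) = ⊤) (r : R) : ∃ s, r ∈ affineSpan x ^ s := by
  have hr : r ∈ Algebra.adjoin ℂ (Set.range x) := hx ▸ trivial
  have hmono {s t : ℕ} (h : s ≤ t) := pow_mono_of_one_mem (one_mem_affineSpan x) h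
  induction hr using Algebra.adjoin_induction with
  | mem r hr =>
    obtain ⟨i, rfl⟩ := hr
    exact ⟨1, by simpa using mem_affineSpan x i⟩
  | algebraMap c => exact ⟨0, by simp⟩
  | add a b _ _ ha hb =>
    obtain ⟨s, hs⟩ := ha
    obtain ⟨t, ht⟩ := hb
    exact ⟨s + t, add_mem (hmono (by omega) hs) (hmono (by omega) ht)⟩
  | mul a b _ _ ha hb =>
    obtain ⟨s, hs⟩ := ha
    obtain ⟨t, ht⟩ := hb
    exact ⟨s + t, by rw [pow_add]; exact Submodule.mul_mem_mul hs ht⟩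

/-- The dimension of the space of polynomials of degree at most `s` in `k` variables. -/
noncomputable def polyDim (k s : ℕ) : ℕ :=
  Module.finrank ℂ ↥(affineSpan (.X : Fin k → MvPolynomial (Fin k) ℂ) ^ s)

instance {σ R : Type*} [Finite σ] [CommRing R] [Algebra ℂ R] (x : σ → R) (s : ℕ) :
    Module.Finite ℂ ↥(affineSpan x ^ s) :=
  Module.Finite.iff_fg.mpr ((fg_affineSpan x).pow s)

theorem polyDim_mono (k : ℕ) : Monotone (polyDim k) := fun _ _ h =>
  Submodule.finrank_mono (pow_mono_of_one_mem (one_mem_affineSpan _) h)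

theorem polyDim_pos (k s : ℕ) : 0 < polyDim k s := by
  have : Nontrivial ↥(affineSpan (.X : Fin k → MvPolynomial (Fin k) ℂ) ^ s) :=
    ⟨⟨1, by simpa using Submodule.pow_mem_pow _ (one_mem_affineSpan _) s⟩, 0, fun h =>
      one_ne_zero (congrArg Subtype.val h)⟩
  exact Module.finrank_pos

/-- A crude count by exponents at most `s` in each variable; only polynomial growth in `s` matters.
-/
theorem polyDim_le (k s : ℕ) : polyDim k s ≤ (s + 1) ^ k := by
  have h1 : affineSpan (.X : Fin k → MvPolynomial (Fin k) ℂ) ^ s ≤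
      MvPolynomial.restrictTotalDegree (Fin k) ℂ s := by
    induction s with
    | zero =>
      rw [pow_zero, Submodule.one_le, MvPolynomial.mem_restrictTotalDegree]
      simp
    | succ s ih =>
      rw [pow_succ, Submodule.mul_le]
      intro p hp q hq
      have h2 : affineSpan (.X : Fin k → MvPolynomial (Fin k) ℂ) ≤
          MvPolynomial.restrictTotalDegree (Fin k) ℂ 1 :=
        affineSpan_le _ (by simp [MvPolynomial.mem_restrictTotalDegree])
          fun i => by simp [MvPolynomial.mem_restrictTotalDegree]
      have hp' := (MvPolynomial.mem_restrictTotalDegree _ _ _).mp (ih hp)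
      have hq' := (MvPolynomial.mem_restrictTotalDegree _ _ _).mp (h2 hq)
      rw [MvPolynomial.mem_restrictTotalDegree]
      exact (MvPolynomial.totalDegree_mul p q).trans (add_le_add hp' hq')
  let T : Set (Fin k →₀ ℕ) := {n | ∀ i, n i ≤ s}
  let j : T → (Fin k → Fin (s + 1)) := fun n i => ⟨n.1 i, Nat.lt_succ_of_le (n.2 i)⟩
  have hj : Function.Injective j := fun n m h => Subtype.ext <| Finsupp.ext fun i =>
    congrArg Fin.val (congrFun h i)
  have : Finite T := Finite.of_injective j hj
  have := Fintype.ofFinite T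
  let b := MvPolynomial.basisRestrictSupport ℂ T
  have : Module.Finite ℂ (MvPolynomial.restrictSupport ℂ T) := Module.Finite.of_basis b
  calc polyDim k s ≤ Module.finrank ℂ (MvPolynomial.restrictSupport ℂ T) :=
        Submodule.finrank_mono (h1.trans (MvPolynomial.restrictTotalDegree_le_restrictDegree _ ℂ s))
    _ = Fintype.card T := Module.finrank_eq_card_basis b
    _ ≤ Fintype.card (Fin k → Fin (s + 1)) := Fintype.card_le_of_injective j hj
    _ = (s + 1) ^ k := by simp

/-- Otherwise every shift by `c` would multiply `polyDim` by at least 1 + 1/N, giving exponential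
growth. Thus bounded shifts of degree cannot account for a whole unit of rank. -/
theorem exists_polyDim_add_lt (k c N : ℕ) :
    ∃ s, N * polyDim k (s + c) < (N + 1) * polyDim k s := by
  by_contra! h
  rcases Nat.eq_zero_or_pos N with rfl | hN
  · have := h 0
    have := polyDim_pos k 0
    simp at *
    omega
  let ρ : ℝ := 1 + 1 / N
  have hN' : (0 : ℝ) < N := by exact_mod_cast hN
  have hρ : 1 < ρ := by simp [ρ, hN]
  have h1 : ∀ m : ℕ, ρ ^ m ≤ polyDim k (m * c) := by
    intro m
    induction m with
    | zero =>
      have : 1 ≤ polyDim k 0 := polyDim_pos k 0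
      simpa using this
    | succ m ih =>
      have h2 : ((N + 1 : ℕ) : ℝ) * polyDim k (m * c) ≤ N * polyDim k (m * c + c) := by
        exact_mod_cast h (m * c)
      rw [pow_succ, Nat.succ_mul]
      have h3 : ρ * N = (N + 1 : ℕ) := by
        simp only [ρ]
        field_simp
        push_cast
        ring
      have h4 : (ρ ^ m * ρ) * N ≤ polyDim k (m * c + c) * N := by
        rw [mul_assoc, h3]
        calc _ ≤ (polyDim k (m * c) : ℝ) * (N + 1 : ℕ) := by gcongr
          _ ≤ _ := by linarith
      exact le_of_mul_le_mul_right h4 hN'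
  have hlim := tendsto_pow_const_div_const_pow_of_one_lt k hρ
  have hC : (0 : ℝ) < ((c + 1 : ℕ) : ℝ) ^ k * 2 ^ k := by positivity
  have hev := (hlim.eventually (gt_mem_nhds (inv_pos.mpr hC))).and (Filter.eventually_ge_atTop 1)
  obtain ⟨m, hm, hm1⟩ := hev.exists
  have h2 : (polyDim k (m * c) : ℝ) ≤ ((c + 1 : ℕ) : ℝ) ^ k * 2 ^ k * (m : ℝ) ^ k := by
    have h3 : polyDim k (m * c) ≤ ((c + 1) * 2 * m) ^ k := by
      refine (polyDim_le _ _).trans (Nat.pow_le_pow_left ?_ k)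
      nlinarith
    rw [← mul_pow, ← mul_pow]
    exact_mod_cast h3
  have hρm : 0 < ρ ^ m := by positivity
  rw [div_lt_iff₀ hρm, inv_mul_eq_div, lt_div_iff₀ hC] at hm
  linarith [h1 m]

/-- The linear map sending a tuple of polynomials of degree at most `s` to the corresponding linear
combination of the `u i`. -/
noncomputable def boundedCombination {k : ℕ} {R ι : Type*} [Fintype ι] [AddCommGroup R] [Module ℂ R]
    [Module (MvPolynomial (Fin k) ℂ) R] [IsScalarTower ℂ (MvPolynomial (Fin k) ℂ) R]
    (u : ι → R) (s : ℕ) :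
    (ι → ↥(affineSpan (.X : Fin k → MvPolynomial (Fin k) ℂ) ^ s)) →ₗ[ℂ] R :=
  ((Fintype.linearCombination (MvPolynomial (Fin k) ℂ) u).restrictScalars ℂ).comp
    (LinearMap.compLeft (Submodule.subtype _) ι)

section

variable {k : ℕ} {R ι : Type*} [Fintype ι] [AddCommGroup R] [Module ℂ R]
  [Module (MvPolynomial (Fin k) ℂ) R] [IsScalarTower ℂ (MvPolynomial (Fin k) ℂ) R] {u : ι → R}

theorem boundedCombination_apply (s : ℕ)
    (a : ι → ↥(affineSpan (.X : Fin k → MvPolynomial (Fin k) ℂ) ^ s)) :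
    boundedCombination u s a = ∑ i, (a i : MvPolynomial (Fin k) ℂ) • u i := rfl

theorem boundedCombination_injective (hu : LinearIndependent (MvPolynomial (Fin k) ℂ) u) (s : ℕ) :
    Function.Injective (boundedCombination (k := k) u s) := by
  refine (LinearIndependent.fintypeLinearCombination_injective hu).comp fun a b h => ?_
  ext1 i
  exact Subtype.ext (congrFun h i)

theorem finrank_boundedTuples (k s : ℕ) (ι : Type*) [Fintype ι] :
    Module.finrank ℂ (ι → ↥(affineSpan (.X : Fin k → MvPolynomial (Fin k) ℂ) ^ s)) =
      Fintype.card ι * polyDim k s := by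
  rw [Module.finrank_pi_fintype]
  simp [polyDim]

end

theorem smul_mem_of_mem_pow_affineSpan {k : ℕ} {σ R : Type*} [CommRing R] [Algebra ℂ R]
    [Algebra (MvPolynomial (Fin k) ℂ) R] [IsScalarTower ℂ (MvPolynomial (Fin k) ℂ) R] {x : σ → R}
    (ht : ∀ i, algebraMap (MvPolynomial (Fin k) ℂ) R (.X i) ∈ affineSpan x) {s c : ℕ}
    {a : MvPolynomial (Fin k) ℂ} (ha : a ∈ affineSpan (.X : Fin k → MvPolynomial (Fin k) ℂ) ^ s)
    {r : R} (hr : r ∈ affineSpan x ^ c) : a • r ∈ affineSpan x ^ (s + c) := by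
  rw [Algebra.smul_def, pow_add]
  refine Submodule.mul_mem_mul ?_ hr
  have h1 := Submodule.mem_map_of_mem
    (f := (IsScalarTower.toAlgHom ℂ (MvPolynomial (Fin k) ℂ) R).toLinearMap) ha
  rw [map_pow_affineSpan] at h1
  exact pow_le_pow_left' (affineSpan_le _ (one_mem_affineSpan x) ht) s h1

/-- Lower bound on growth: a maximal independent family has some bounded degree `c`, and its
combinations with coefficients of degree at most `s` are independent inside the step `s + c`. -/
theorem exists_finrank_mul_polyDim_le {k : ℕ} {σ R : Type*} [Finite σ] [CommRing R] [Algebra ℂ R]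
    [Algebra (MvPolynomial (Fin k) ℂ) R] [IsScalarTower ℂ (MvPolynomial (Fin k) ℂ) R] {x : σ → R}
    (hx : Algebra.adjoin ℂ (Set.range x) = ⊤)
    (ht : ∀ i, algebraMap (MvPolynomial (Fin k) ℂ) R (.X i) ∈ affineSpan x) :
    ∃ c, ∀ s, Module.finrank (MvPolynomial (Fin k) ℂ) R * polyDim k s ≤
      Module.finrank ℂ ↥(affineSpan x ^ (s + c)) := by
  obtain ⟨u, hu⟩ := exists_linearIndependent_of_le_finrank
    (le_refl (Module.finrank (MvPolynomial (Fin k) ℂ) R))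
  choose c hc using fun i => exists_mem_pow_affineSpan hx (u i)
  refine ⟨∑ i, c i, fun s => ?_⟩
  have hmem : ∀ a, boundedCombination (k := k) u s a ∈ affineSpan x ^ (s + ∑ i, c i) := by
    intro a
    rw [boundedCombination_apply]
    exact Submodule.sum_mem _ fun i _ => smul_mem_of_mem_pow_affineSpan ht (a i).2
      (pow_mono_of_one_mem (one_mem_affineSpan x)
        (Finset.single_le_sum (fun _ _ => Nat.zero_le _) (Finset.mem_univ i)) (hc i))
  have := LinearMap.finrank_le_finrank_of_injective
    (f := (boundedCombination (k := k) u s).codRestrict _ hmem)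
    fun a b h => boundedCombination_injective hu s (congrArg Subtype.val h)
  rwa [finrank_boundedTuples, Fintype.card_fin] at this

/-- Every element of degree at most `s` is a combination of elements of degree at most `E` with
coefficients polynomials of degree at most `s` in the `t i`. -/
def IsFilteredFinite {κ R : Type*} [CommRing R] [Algebra ℂ R] (t : κ → R) (V : Submodule ℂ R) :
    Prop :=
  ∃ E, V ^ (E + 1) ≤ affineSpan t * V ^ E

/-- The single inclusion in degree E + 1 is iterated, peeling off one factor from the span of `t` at
each step. -/
theorem IsFilteredFinite.exists_pow_le {κ R : Type*} [CommRing R] [Algebra ℂ R] {t : κ → R}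
    {V : Submodule ℂ R} (h : IsFilteredFinite t V) (h1 : 1 ∈ V) :
    ∃ E, ∀ s, V ^ s ≤ affineSpan t ^ s * V ^ E := by
  obtain ⟨E, hE⟩ := h
  refine ⟨E, fun s => (pow_mono_of_one_mem h1 (Nat.le_add_left s E)).trans ?_⟩
  induction s with
  | zero => simp
  | succ s ih =>
    calc V ^ (E + (s + 1)) = V ^ (E + s) * V := by rw [← add_assoc, pow_succ]
      _ ≤ affineSpan t ^ s * V ^ E * V := mul_le_mul_left ih _
      _ = affineSpan t ^ s * V ^ (E + 1) := by rw [mul_assoc, pow_succ]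
      _ ≤ affineSpan t ^ s * (affineSpan t * V ^ E) := mul_le_mul_right hE _
      _ = affineSpan t ^ (s + 1) * V ^ E := by rw [← mul_assoc, pow_succ]

theorem pow_affineSpan_le_range_boundedCombination {k : ℕ} {σ R ι : Type*} [Fintype ι] [CommRing R]
    [Algebra ℂ R] [Algebra (MvPolynomial (Fin k) ℂ) R] [IsScalarTower ℂ (MvPolynomial (Fin k) ℂ) R]
    {x : σ → R} {E s : ℕ} (b : Module.Basis ι ℂ ↥(affineSpan x ^ E))
    (hE : affineSpan x ^ s ≤ affineSpan (fun i : Fin k =>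
      algebraMap (MvPolynomial (Fin k) ℂ) R (.X i)) ^ s * affineSpan x ^ E) :
    affineSpan x ^ s ≤ LinearMap.range (boundedCombination (k := k) (fun i => (b i : R)) s) := by
  refine hE.trans (Submodule.mul_le.mpr fun a ha r hr => ?_)
  have ha' : a ∈ (affineSpan MvPolynomial.X ^ s).map
      (IsScalarTower.toAlgHom ℂ (MvPolynomial (Fin k) ℂ) R).toLinearMap := by
    rwa [map_pow_affineSpan]
  obtain ⟨a, ha', rfl⟩ := ha'
  refine ⟨fun i => ⟨b.repr ⟨r, hr⟩ i • a, Submodule.smul_mem _ _ ha'⟩, ?_⟩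
  rw [boundedCombination_apply]
  have h2 := congrArg Subtype.val (b.sum_repr ⟨r, hr⟩)
  simp only [Submodule.coe_sum, Submodule.coe_smul] at h2
  conv_rhs => rw [← h2]
  rw [Finset.mul_sum]
  refine Finset.sum_congr rfl fun i _ => ?_
  change (b.repr ⟨r, hr⟩ i • a) • (b i : R) = algebraMap _ R a * (b.repr ⟨r, hr⟩ i • (b i : R))
  rw [smul_assoc, Algebra.smul_def a, Algebra.mul_smul_comm]

/-- The lower bound again, now for the module of relations among the `u i`: independent relations of
bounded degree yield many relations in each degree. -/
theorem exists_finrank_ker_mul_polyDim_le {k N : ℕ} {R : Type*} [AddCommGroup R] [Module ℂ R]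
    [Module (MvPolynomial (Fin k) ℂ) R] [IsScalarTower ℂ (MvPolynomial (Fin k) ℂ) R]
    (u : Fin N → R) : ∃ c, ∀ s,
      Module.finrank (MvPolynomial (Fin k) ℂ)
        (LinearMap.ker (Fintype.linearCombination (MvPolynomial (Fin k) ℂ) u)) * polyDim k s ≤
      Module.finrank ℂ (LinearMap.ker (boundedCombination (k := k) u (s + c))) := by
  obtain ⟨v, hv⟩ := exists_linearIndependent_of_le_finrank
    (le_refl (Module.finrank (MvPolynomial (Fin k) ℂ)
      (LinearMap.ker (Fintype.linearCombination (MvPolynomial (Fin k) ℂ) u))))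
  have hv' : LinearIndependent (MvPolynomial (Fin k) ℂ)
      (fun i => (v i : Fin N → MvPolynomial (Fin k) ℂ)) :=
    hv.map' (Submodule.subtype _) (Submodule.ker_subtype _)
  choose c hc using fun ij : Fin _ × Fin N => exists_mem_pow_affineSpan
    MvPolynomial.adjoin_range_X ((v ij.1 : Fin N → MvPolynomial (Fin k) ℂ) ij.2)
  refine ⟨∑ ij, c ij, fun s => ?_⟩
  let θ := boundedCombination (k := k) (fun i => (v i : Fin N → MvPolynomial (Fin k) ℂ)) s
  have hmem : ∀ a j, θ a j ∈ affineSpan (.X : Fin k → MvPolynomial (Fin k) ℂ) ^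
      (s + ∑ ij, c ij) := by
    intro a j
    rw [boundedCombination_apply, Finset.sum_apply]
    refine Submodule.sum_mem _ fun i _ => ?_
    rw [Pi.smul_apply, smul_eq_mul, pow_add]
    exact Submodule.mul_mem_mul (a i).2 (pow_mono_of_one_mem (one_mem_affineSpan _)
      (Finset.single_le_sum (f := c) (fun _ _ => Nat.zero_le _) (Finset.mem_univ (i, j)))
      (hc (i, j)))
  have hker : ∀ a, Fintype.linearCombination (MvPolynomial (Fin k) ℂ) u (θ a) = 0 := by
    intro a
    rw [boundedCombination_apply, map_sum]
    refine Finset.sum_eq_zero fun i _ => ?_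
    rw [map_smul, LinearMap.mem_ker.mp (v i).2, smul_zero]
  let θ' := (LinearMap.pi fun j => ((LinearMap.proj j).comp θ).codRestrict _ fun a =>
    hmem a j).codRestrict (LinearMap.ker (boundedCombination (k := k) u (s + ∑ ij, c ij))) hker
  have hθ' : Function.Injective θ' := by
    intro a b h
    apply boundedCombination_injective hv' s
    ext1 j
    exact congrArg Subtype.val (congrFun (congrArg Subtype.val h) j)
  have h3 := LinearMap.finrank_le_finrank_of_injective hθ'
  rwa [finrank_boundedTuples, Fintype.card_fin] at h3

/-- Upper bound on growth. Fixed generators of some number N span each step with coefficients of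
bounded degree; rank–nullity then subtracts the relations, whose module has rank N minus the rank of
`R`. The subtraction does not truncate, since the rank is at most N. -/
theorem exists_finrank_add_le {k : ℕ} {σ R : Type} [Finite σ] [CommRing R] [Algebra ℂ R]
    [Algebra (MvPolynomial (Fin k) ℂ) R] [IsScalarTower ℂ (MvPolynomial (Fin k) ℂ) R] {x : σ → R}
    (hx : Algebra.adjoin ℂ (Set.range x) = ⊤)
    (hf : IsFilteredFinite (fun i => algebraMap (MvPolynomial (Fin k) ℂ) R (.X i))
      (affineSpan x)) :
    ∃ N c, Module.finrank (MvPolynomial (Fin k) ℂ) R ≤ N ∧ ∀ s,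
      Module.finrank ℂ ↥(affineSpan x ^ (s + c)) +
        (N - Module.finrank (MvPolynomial (Fin k) ℂ) R) * polyDim k s ≤
      N * polyDim k (s + c) := by
  obtain ⟨E, hE⟩ := hf.exists_pow_le (one_mem_affineSpan x)
  obtain ⟨N, u, hle⟩ : ∃ (N : ℕ) (u : Fin N → R), ∀ s,
      affineSpan x ^ s ≤ LinearMap.range (boundedCombination (k := k) u s) :=
    ⟨_, _, fun s => pow_affineSpan_le_range_boundedCombination (Module.finBasis ℂ _) (hE s)⟩
  have hφ : LinearMap.range (Fintype.linearCombination (MvPolynomial (Fin k) ℂ) u) = ⊤ := by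
    rw [eq_top_iff]
    rintro r -
    obtain ⟨s, hs⟩ := exists_mem_pow_affineSpan hx r
    obtain ⟨a, ha⟩ := hle s hs
    exact ⟨_, ha⟩
  have hrank := Submodule.finrank_quotient_add_finrank
    (LinearMap.ker (Fintype.linearCombination (MvPolynomial (Fin k) ℂ) u))
  rw [(LinearMap.quotKerEquivRange _).finrank_eq, hφ, finrank_top, Module.finrank_fin_fun] at hrank
  obtain ⟨c, hc⟩ := exists_finrank_ker_mul_polyDim_le (k := k) u
  refine ⟨N, c, by omega, fun s => ?_⟩
  have h1 := Submodule.finrank_mono (hle (s + c))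
  have h2 := LinearMap.finrank_range_add_finrank_ker (boundedCombination (k := k) u (s + c))
  rw [finrank_boundedTuples, Fintype.card_fin] at h2
  have h3 := hc s
  rw [show Module.finrank (MvPolynomial (Fin k) ℂ)
    (LinearMap.ker (Fintype.linearCombination (MvPolynomial (Fin k) ℂ) u)) =
      N - Module.finrank (MvPolynomial (Fin k) ℂ) R by omega] at h3
  omega

/-- The rank of `R` as a module over the polynomial ring acting through the family `t`. -/
noncomputable def rankOver {k : ℕ} {R : Type*} [CommRing R] [Algebra ℂ R] (t : Fin k → R) : ℕ :=
  @Module.finrank (MvPolynomial (Fin k) ℂ) R _ _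
    (MvPolynomial.aeval (R := ℂ) t).toRingHom.toAlgebra.toModule

/-- The rank over a filtered finite polynomial subalgebra is determined by the growth of the
filtration. -/
theorem rankOver_le_of_isFilteredFinite {k : ℕ} {σ R : Type} [Finite σ] [CommRing R] [Algebra ℂ R]
    {x : σ → R} (hx : Algebra.adjoin ℂ (Set.range x) = ⊤) (t t' : Fin k → R)
    (ht : ∀ i, t i ∈ affineSpan x) (ht' : IsFilteredFinite t' (affineSpan x)) :
    rankOver t ≤ rankOver t' := by
  have h1 : ∃ c, ∀ s, rankOver t * polyDim k s ≤ Module.finrank ℂ ↥(affineSpan x ^ (s + c)) := by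
    let _ : Algebra (MvPolynomial (Fin k) ℂ) R := (MvPolynomial.aeval t).toRingHom.toAlgebra
    have : IsScalarTower ℂ (MvPolynomial (Fin k) ℂ) R :=
      .of_algebraMap_eq' (MvPolynomial.aeval t).comp_algebraMap.symm
    refine exists_finrank_mul_polyDim_le hx fun i => ?_
    rw [show algebraMap (MvPolynomial (Fin k) ℂ) R (.X i) = t i from MvPolynomial.aeval_X t i]
    exact ht i
  have h2 : ∃ N c, rankOver t' ≤ N ∧ ∀ s, Module.finrank ℂ ↥(affineSpan x ^ (s + c)) +
      (N - rankOver t') * polyDim k s ≤ N * polyDim k (s + c) := by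
    let _ : Algebra (MvPolynomial (Fin k) ℂ) R := (MvPolynomial.aeval t').toRingHom.toAlgebra
    have : IsScalarTower ℂ (MvPolynomial (Fin k) ℂ) R :=
      .of_algebraMap_eq' (MvPolynomial.aeval t').comp_algebraMap.symm
    refine exists_finrank_add_le hx ?_
    convert! ht' using 2 with i
    exact MvPolynomial.aeval_X t' i
  obtain ⟨c, hc⟩ := h1
  obtain ⟨N, c', hN, hc'⟩ := h2
  by_contra! hlt
  -- With r > r' the two bounds give (N + 1) p(s) ≤ N p(s + c + c') for p = `polyDim k`, which this
  -- `s` violates.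
  obtain ⟨s, hs⟩ := exists_polyDim_add_lt k (c + c') N
  have h3 := hc (s + c')
  have h4 := hc' (s + c)
  have e : s + c' + c = s + c + c' := by ring
  rw [e] at h3
  rw [← add_assoc] at hs
  have h5 : (rankOver t' + 1) * polyDim k s ≤ rankOver t * polyDim k (s + c') :=
    Nat.mul_le_mul hlt (polyDim_mono k (by omega))
  have h6 : (N - rankOver t') * polyDim k s ≤ (N - rankOver t') * polyDim k (s + c) :=
    Nat.mul_le_mul_left _ (polyDim_mono k (by omega))
  have h7 : (rankOver t' + 1) * polyDim k s + (N - rankOver t') * polyDim k s =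
      (N + 1) * polyDim k s := by
    rw [← add_mul]
    congr 1
    omega
  omega

end Hilbert

/-! ### Rees algebras and integrality in degree one -/

/-- The determinant trick: Cayley–Hamilton for multiplication by `x` on `N`, evaluated at 1 ∈ `N`.
-/
theorem isIntegral_of_mul_mem {A B : Type*} [CommRing A] [CommRing B] [Algebra A B]
    {N : Submodule A B} (hN : N.FG) (h1 : 1 ∈ N) {x : B} (hx : ∀ n ∈ N, x * n ∈ N) :
    IsIntegral A x := by
  have : Module.Finite A N := Module.Finite.iff_fg.mpr hN
  let f : Module.End A N := (LinearMap.mulLeft A x).restrict hx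
  obtain ⟨p, hp, hpf⟩ := LinearMap.exists_monic_and_aeval_eq_zero A f
  refine ⟨p, hp, ?_⟩
  have h2 : (Polynomial.aeval f p ⟨1, h1⟩ : B) = Polynomial.aeval x p := by
    have h3 : ∀ n : ℕ, (((f ^ n) ⟨1, h1⟩ : N) : B) = x ^ n := by
      intro n
      induction n with
      | zero => simp
      | succ n ih =>
        rw [pow_succ', Module.End.mul_apply, pow_succ', ← ih]
        rfl
    rw [Polynomial.aeval_eq_sum_range, Polynomial.aeval_eq_sum_range, LinearMap.sum_apply,
      Submodule.coe_sum]
    refine Finset.sum_congr rfl fun i _ => ?_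
    rw [LinearMap.smul_apply, Submodule.coe_smul, h3]
  rw [← Polynomial.aeval_def, ← h2, hpf]
  rfl

section Rees

open Polynomial

variable {R : Type*} [CommRing R] [Algebra ℂ R]

/-- The Rees algebra of the filtration of `R` by the powers of `V`. -/
noncomputable def reesAlg (V : Submodule ℂ R) : Subalgebra ℂ R[X] :=
  Algebra.adjoin ℂ (monomial 1 '' (V : Set R))

theorem monomial_one_mem_reesAlg {V : Submodule ℂ R} {v : R} (hv : v ∈ V) :
    monomial 1 v ∈ reesAlg V :=
  Algebra.subset_adjoin ⟨v, hv, rfl⟩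

theorem coeff_mem_of_mem_reesAlg {V : Submodule ℂ R} {p : R[X]} (hp : p ∈ reesAlg V) (s : ℕ) :
    p.coeff s ∈ V ^ s := by
  induction hp using Algebra.adjoin_induction generalizing s with
  | mem p hp =>
    obtain ⟨v, hv, rfl⟩ := hp
    rw [coeff_monomial]
    split_ifs with h
    · rw [← h, pow_one]
      exact hv
    · exact zero_mem _
  | algebraMap c =>
    rw [Polynomial.algebraMap_apply, coeff_C]
    split_ifs with h
    · rw [h, pow_zero]
      exact Submodule.algebraMap_mem c
    · exact zero_mem _
  | add p q _ _ hp hq => exact add_mem (hp s) (hq s)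
  | mul p q _ _ hp hq =>
    rw [coeff_mul]
    refine Submodule.sum_mem _ fun ij hij => ?_
    rw [← Finset.HasAntidiagonal.mem_antidiagonal.mp hij, pow_add]
    exact Submodule.mul_mem_mul (hp _) (hq _)

theorem monomial_mem_reesAlg {V : Submodule ℂ R} {s : ℕ} {v : R} (hv : v ∈ V ^ s) :
    monomial s v ∈ reesAlg V := by
  induction s generalizing v with
  | zero =>
    obtain ⟨c, rfl⟩ := Submodule.mem_one.mp hv
    exact (reesAlg V).algebraMap_mem c
  | succ s ih =>
    rw [pow_succ] at hv
    induction hv using Submodule.mul_induction_on' with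
    | mem_mul_mem a ha b hb =>
      rw [← monomial_mul_monomial]
      exact mul_mem (ih ha) (monomial_one_mem_reesAlg hb)
    | add a _ b _ ha hb =>
      rw [map_add]
      exact add_mem ha hb

/-- The degree one part of the Rees algebra of `V` is integral over the Rees algebra of `U`. -/
def IsReesIntegral (U V : Submodule ℂ R) : Prop :=
  ∀ v ∈ V, IsIntegral (reesAlg U) (monomial 1 v : R[X])

theorem IsReesIntegral.of_mem_reesAlg {U V : Submodule ℂ R} (h : IsReesIntegral U V) {p : R[X]}
    (hp : p ∈ reesAlg V) : IsIntegral (reesAlg U) p := by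
  induction hp using Algebra.adjoin_induction with
  | mem p hp =>
    obtain ⟨v, hv, rfl⟩ := hp
    exact h v hv
  | algebraMap c =>
    rw [IsScalarTower.algebraMap_apply ℂ (reesAlg U) R[X]]
    exact isIntegral_algebraMap
  | add p q _ _ hp hq => exact hp.add hq
  | mul p q _ _ hp hq => exact hp.mul hq

theorem IsReesIntegral.trans_isIntegral {U V : Submodule ℂ R} (h : IsReesIntegral U V) {p : R[X]}
    (hp : IsIntegral (reesAlg V) p) : IsIntegral (reesAlg U) p := by
  have h1 : IsIntegral (integralClosure (reesAlg U) R[X]) p :=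
    hp.map_of_comp_eq (φ := (reesAlg V).val.toRingHom.codRestrict
    (integralClosure (reesAlg U) R[X]) fun a => h.of_mem_reesAlg a.2) (ψ := RingHom.id _) rfl
  exact isIntegral_trans p h1

theorem IsReesIntegral.trans {U V W : Submodule ℂ R} (h : IsReesIntegral U V)
    (h' : IsReesIntegral V W) : IsReesIntegral U W :=
  fun w hw => h.trans_isIntegral (h' w hw)

theorem isReesIntegral_of_le {U V : Submodule ℂ R} (h : V ≤ U) : IsReesIntegral U V := fun v hv =>
  isIntegral_algebraMap (R := reesAlg U) (A := R[X])
    (x := ⟨monomial 1 v, monomial_one_mem_reesAlg (h hv)⟩)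

theorem IsReesIntegral.sup {U V W : Submodule ℂ R} (h : IsReesIntegral U V)
    (h' : IsReesIntegral U W) : IsReesIntegral U (V ⊔ W) := by
  intro v hv
  obtain ⟨a, ha, b, hb, rfl⟩ := Submodule.mem_sup.mp hv
  rw [map_add]
  exact (h a ha).add (h' b hb)

theorem isReesIntegral_span {U : Submodule ℂ R} {s : Set R}
    (h : ∀ v ∈ s, IsIntegral (reesAlg U) (monomial 1 v : R[X])) :
    IsReesIntegral U (Submodule.span ℂ s) := by
  intro v hv
  induction hv using Submodule.span_induction with
  | mem v hv => exact h v hv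
  | zero =>
    rw [map_zero]
    exact isIntegral_zero
  | add a b _ _ ha hb =>
    rw [map_add]
    exact ha.add hb
  | smul c a _ ha =>
    have : (monomial 1 (c • a) : R[X]) = c • monomial 1 a := (smul_monomial c 1 a).symm
    rw [this]
    exact ha.smul c

/-- Integrality makes the Rees algebra of `V` a finite module over that of `U`. Take E bounding the
degrees of the generators: in degree E + 1 every coefficient has positive degree, so a factor from
`U` splits off. -/
theorem IsReesIntegral.exists_pow_succ_le {U V : Submodule ℂ R} (h : IsReesIntegral U V)
    (hUV : U ≤ V) (hV : V.FG) : ∃ E, V ^ (E + 1) ≤ U * V ^ E := by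
  obtain ⟨G, hG⟩ := hV
  let B : Subalgebra (reesAlg U) R[X] := Algebra.adjoin (reesAlg U) (monomial 1 '' (G : Set R))
  have hB : B.toSubmodule.FG := by
    refine fg_adjoin_of_finite (G.finite_toSet.image _) ?_
    rintro _ ⟨v, hv, rfl⟩
    exact h v (hG ▸ Submodule.subset_span hv)
  have hVB : reesAlg V ≤ B.restrictScalars ℂ := by
    rw [reesAlg, Algebra.adjoin_le_iff]
    rintro _ ⟨v, hv, rfl⟩
    rw [← hG] at hv
    have : Submodule.span ℂ (G : Set R) ≤ (Subalgebra.toSubmodule (B.restrictScalars ℂ)).comap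
        ((monomial 1).restrictScalars ℂ) := by
      rw [Submodule.span_le]
      exact fun v hv => Algebra.subset_adjoin ⟨v, hv, rfl⟩
    exact this hv
  have hBV : ∀ p ∈ B, p ∈ reesAlg V := by
    intro p hp
    induction hp using Algebra.adjoin_induction with
    | mem p hp =>
      obtain ⟨v, hv, rfl⟩ := hp
      exact monomial_one_mem_reesAlg (hG ▸ Submodule.subset_span hv)
    | algebraMap a => exact Algebra.adjoin_mono (Set.image_mono hUV) a.2
    | add p q _ _ hp hq => exact add_mem hp hq
    | mul p q _ _ hp hq => exact mul_mem hp hq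
  obtain ⟨T, hT⟩ := hB
  let E := T.sup natDegree
  refine ⟨E, fun v hv => ?_⟩
  have hmem : monomial (E + 1) v ∈ Submodule.span (reesAlg U) (T : Set R[X]) := by
    rw [hT]
    exact hVB (monomial_mem_reesAlg hv)
  obtain ⟨a, -, ha⟩ := Submodule.mem_span_finset.mp hmem
  have hv' : v = (∑ m ∈ T, a m • m).coeff (E + 1) := by rw [ha, coeff_monomial_same]
  rw [hv', finsetSum_coeff]
  refine Submodule.sum_mem _ fun m hm => ?_
  rw [Subalgebra.smul_def, smul_eq_mul, coeff_mul]
  refine Submodule.sum_mem _ fun ij hij => ?_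
  rw [Finset.HasAntidiagonal.mem_antidiagonal] at hij
  by_cases hj : E < ij.2
  · rw [coeff_eq_zero_of_natDegree_lt (lt_of_le_of_lt (Finset.le_sup hm) hj), mul_zero]
    exact zero_mem _
  · obtain ⟨i, hi⟩ : ∃ i, ij.1 = i + 1 := ⟨ij.1 - 1, by omega⟩
    have h1 := coeff_mem_of_mem_reesAlg (a m).2 ij.1
    have h2 := coeff_mem_of_mem_reesAlg (hBV m (by
      rw [← Subalgebra.mem_toSubmodule, ← hT]
      exact Submodule.subset_span hm)) ij.2
    have h3 := Submodule.mul_mem_mul h1 h2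
    rw [hi, pow_succ', mul_assoc] at h3
    rw [hi]
    refine mul_le_mul_right ((mul_le_mul_left (pow_le_pow_left' hUV i) _).trans ?_) U h3
    rw [← pow_add]
    exact (congrArg (V ^ ·) (show i + ij.2 = E by omega)).le

/-- The converse: the module generated by the graded pieces of degree at most `E` is finite,
contains 1, and is stable under multiplication by degree-one elements, since the piece of degree E +
1 falls back into it. -/
theorem isReesIntegral_of_pow_succ_le {U V : Submodule ℂ R} (hV : V.FG) {E : ℕ}
    (h : V ^ (E + 1) ≤ U * V ^ E) : IsReesIntegral U V := by
  intro v hv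
  choose G hG using fun s => hV.pow s
  let N : Submodule (reesAlg U) R[X] :=
    Submodule.span _ (⋃ s ∈ Finset.range (E + 1), monomial s '' (G s : Set R))
  have hN : N.FG := Submodule.fg_span (Set.Finite.biUnion (Finset.finite_toSet _) fun s _ =>
    (G s).finite_toSet.image _)
  have hmem : ∀ s ≤ E, ∀ w ∈ V ^ s, monomial s w ∈ N := by
    intro s hs w hw
    rw [← hG] at hw
    have : Submodule.span ℂ (G s : Set R) ≤ (N.restrictScalars ℂ).comap
        ((monomial s).restrictScalars ℂ) := by
      rw [Submodule.span_le]
      refine fun w hw => Submodule.subset_span ?_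
      exact Set.mem_biUnion (Finset.mem_range.mpr (Nat.lt_succ_of_le hs)) ⟨w, hw, rfl⟩
    exact this hw
  have hlast : ∀ w ∈ V ^ (E + 1), monomial (E + 1) w ∈ N := by
    intro w hw
    have : U * V ^ E ≤ (N.restrictScalars ℂ).comap ((monomial (E + 1)).restrictScalars ℂ) := by
      rw [Submodule.mul_le]
      intro u hu w hw
      change monomial (E + 1) (u * w) ∈ N
      rw [add_comm, ← monomial_mul_monomial]
      exact N.smul_mem ⟨_, monomial_one_mem_reesAlg hu⟩ (hmem E le_rfl w hw)
    exact this (h hw)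
  have hstable : ∀ n ∈ N, monomial 1 v * n ∈ N := by
    intro n hn
    have : N ≤ N.comap (LinearMap.mulLeft (reesAlg U) (monomial 1 v)) := by
      rw [Submodule.span_le]
      intro p hp
      simp only [Set.mem_iUnion, Finset.mem_range] at hp
      obtain ⟨s, hs, w, hw, rfl⟩ := hp
      change monomial 1 v * monomial s w ∈ N
      have hw' : v * w ∈ V ^ (s + 1) := by
        rw [pow_succ']
        exact Submodule.mul_mem_mul hv (hG s ▸ Submodule.subset_span hw)
      rw [monomial_mul_monomial, add_comm]
      rcases Nat.lt_or_ge s E with h1 | h1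
      · exact hmem _ h1 _ hw'
      · obtain rfl : s = E := by omega
        exact hlast _ hw'
    exact this hn
  have h1N : (1 : R[X]) ∈ N := by
    have := hmem 0 (Nat.zero_le _) 1 (by rw [pow_zero]; exact Submodule.one_le.mp le_rfl)
    simpa using this
  exact isIntegral_of_mul_mem hN h1N hstable

end Rees

/-! ### Noether normalization by linear forms -/

section LinearNoether

open Polynomial

theorem isIntegral_of_isUnit_coeff {A B : Type*} [CommRing A] [CommRing B] [Algebra A B] {p : A[X]}
    {d : ℕ} (hd : p.natDegree ≤ d) (hu : IsUnit (p.coeff d)) {x : B} (hx : aeval x p = 0) :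
    IsIntegral A x := by
  obtain ⟨a, ha⟩ := hu.exists_left_inv
  refine ⟨C a * p, monic_of_natDegree_le_of_coeff_eq_one d ?_ ?_, ?_⟩
  · exact (natDegree_C_mul_le a p).trans hd
  · rw [coeff_C_mul, ha]
  · rw [← aeval_def, map_mul, hx, mul_zero]

/-- The coefficient is taken at the formal degree because some `l i` may vanish. -/
theorem prod_linear_pow {A ι : Type*} [CommRing A] (s : Finset ι) (w l : ι → A) (m : ι → ℕ) :
    (∏ i ∈ s, (C (w i) + C (l i) * X) ^ m i).natDegree ≤ ∑ i ∈ s, m i ∧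
    (∏ i ∈ s, (C (w i) + C (l i) * X) ^ m i).coeff (∑ i ∈ s, m i) = ∏ i ∈ s, l i ^ m i := by
  classical
  have h1 : ∀ i, (C (w i) + C (l i) * X).natDegree ≤ 1 := fun i => by
    rw [add_comm]
    exact natDegree_linear_le
  have h2 : ∀ i, ((C (w i) + C (l i) * X) ^ m i).natDegree ≤ m i := fun i => by
    simpa using natDegree_pow_le_of_le (m i) (h1 i)
  have h3 : ∀ i, ((C (w i) + C (l i) * X) ^ m i).coeff (m i) = l i ^ m i := fun i => by
    have := coeff_pow_of_natDegree_le (m := m i) (h1 i)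
    rw [mul_one] at this
    rw [this]
    simp
  induction s using Finset.induction_on with
  | empty => simp
  | insert i s hi ih =>
    rw [Finset.prod_insert hi, Finset.sum_insert hi, Finset.prod_insert hi]
    refine ⟨natDegree_mul_le_of_le (h2 i) ih.1, ?_⟩
    rw [coeff_mul_add_eq_of_natDegree_le (h2 i) ih.1, h3, ih.2]

theorem prod_monomial_one_pow {R ι : Type*} [CommRing R] (s : Finset ι) (a : ι → R) (m : ι → ℕ) :
    ∏ i ∈ s, (monomial 1 (a i) : R[X]) ^ m i = monomial (∑ i ∈ s, m i) (∏ i ∈ s, a i ^ m i) := by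
  classical
  induction s using Finset.induction_on with
  | empty => simp
  | insert i s hi ih =>
    rw [Finset.prod_insert hi, Finset.sum_insert hi, Finset.prod_insert hi, ih, monomial_pow,
      monomial_mul_monomial, one_mul]

theorem exists_eval_homogeneousComponent_ne_zero {n : ℕ} {f : MvPolynomial (Fin n) ℂ}
    (hf : f ≠ 0) :
    ∃ l, MvPolynomial.eval l (MvPolynomial.homogeneousComponent f.totalDegree f) ≠ 0 := by
  by_contra! h
  have h0 : MvPolynomial.homogeneousComponent f.totalDegree f = 0 :=
    MvPolynomial.funext fun v => by simpa using h v
  obtain ⟨m, hm, hmd⟩ := Finset.exists_mem_eq_sup f.support (MvPolynomial.support_nonempty.mpr hf)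
    fun s => s.sum fun _ e => e
  have h1 := congrArg (MvPolynomial.coeff m) h0
  rw [MvPolynomial.coeff_homogeneousComponent, if_pos, MvPolynomial.coeff_zero] at h1
  · exact MvPolynomial.mem_support_iff.mp hm h1
  · exact hmd.symm

/-- If linear forms `e i` satisfy a relation `f` whose leading form does not vanish at `l`, then a
linear form `t` is integral over the forms `e i - l i • t`. -/
theorem isIntegral_of_relation {R : Type*} [CommRing R] [Algebra ℂ R] {U : Submodule ℂ R}
    (h1 : 1 ∈ U) {n : ℕ} {e : Fin n → R} {f : MvPolynomial (Fin n) ℂ}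
    (hf : MvPolynomial.aeval e f = 0) {l : Fin n → ℂ}
    (hl : MvPolynomial.eval l (MvPolynomial.homogeneousComponent f.totalDegree f) ≠ 0) {t : R}
    (ht : ∀ i, e i - l i • t ∈ U) : IsIntegral (reesAlg U) (monomial 1 t : R[X]) := by
  let A := reesAlg U
  -- `z` is the Rees variable T. It supplies the missing degree in the lower terms of `f`, so that
  -- substituting T·t for the unknown in `p` below gives T^d · f(e) = 0, while its coefficient in
  -- degree d is the leading form of `f` at `l`.
  let z : A := ⟨monomial 1 1, monomial_one_mem_reesAlg h1⟩
  let w : Fin n → A := fun i => ⟨monomial 1 (e i - l i • t), monomial_one_mem_reesAlg (ht i)⟩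
  let d := f.totalDegree
  have hd : ∀ m ∈ f.support, ∑ i, m i ≤ d := fun m hm => by
    have := MvPolynomial.le_totalDegree hm
    rwa [Finsupp.sum_fintype _ _ fun _ => rfl] at this
  let c : (Fin n →₀ ℕ) → A := fun m => algebraMap ℂ A (f.coeff m) * z ^ (d - ∑ i, m i)
  let q : (Fin n →₀ ℕ) → A[X] := fun m =>
    ∏ i, (C (w i) + C (algebraMap ℂ A (l i)) * X) ^ m i
  have hq := fun m : Fin n →₀ ℕ =>
    prod_linear_pow Finset.univ w (fun i => algebraMap ℂ A (l i)) m
  let p : A[X] := ∑ m ∈ f.support, C (c m) * q m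
  have hdeg : p.natDegree ≤ d := natDegree_sum_le_of_forall_le _ _ fun m hm =>
    ((natDegree_C_mul_le _ _).trans (hq m).1).trans (hd m hm)
  have hcoeff : p.coeff d = algebraMap ℂ A
      (MvPolynomial.eval l (MvPolynomial.homogeneousComponent f.totalDegree f)) := by
    rw [MvPolynomial.homogeneousComponent_apply, map_sum, map_sum, finsetSum_coeff,
      Finset.sum_filter]
    refine Finset.sum_congr rfl fun m hm => ?_
    rw [coeff_C_mul, Finsupp.degree_eq_sum]
    split_ifs with hmd
    · have h2 : (q m).coeff d = ∏ i, algebraMap ℂ A (l i) ^ m i := by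
        rw [← (hq m).2, hmd]
      rw [h2]
      have h3 : d - ∑ i, m i = 0 := by omega
      simp only [c, h3, pow_zero, mul_one, MvPolynomial.eval_monomial,
        Finsupp.prod_pow, map_mul, map_prod, map_pow]
    · rw [coeff_eq_zero_of_natDegree_lt, mul_zero]
      exact lt_of_le_of_lt (hq m).1 (lt_of_le_of_ne (hd m hm) hmd)
  refine isIntegral_of_isUnit_coeff hdeg (hcoeff ▸ (IsUnit.mk0 _ hl).map _) ?_
  have hterm : ∀ m ∈ f.support, aeval (monomial 1 t : R[X]) (C (c m) * q m) =
      monomial d (f.coeff m • ∏ i, e i ^ m i) := by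
    intro m hm
    have h2 : ∀ i, aeval (monomial 1 t : R[X]) (C (w i) + C (algebraMap ℂ A (l i)) * X) =
        monomial 1 (e i) := by
      intro i
      rw [map_add, map_mul, aeval_C, aeval_C, aeval_X, ← IsScalarTower.algebraMap_apply,
        ← Algebra.smul_def, smul_monomial]
      change monomial 1 (e i - l i • t) + monomial 1 (l i • t) = monomial 1 (e i)
      rw [← map_add, sub_add_cancel]
    have h3 : aeval (monomial 1 t : R[X]) (q m) = monomial (∑ i, m i) (∏ i, e i ^ m i) := by
      rw [← prod_monomial_one_pow, map_prod]
      exact Finset.prod_congr rfl fun i _ => by rw [map_pow, h2]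
    have h4 : algebraMap A R[X] (c m) = f.coeff m • monomial (d - ∑ i, m i) 1 := by
      simp only [c]
      rw [map_mul, map_pow, ← IsScalarTower.algebraMap_apply, ← Algebra.smul_def]
      change f.coeff m • (monomial 1 (1 : R)) ^ _ = _
      rw [monomial_pow, one_mul, one_pow]
    rw [map_mul, aeval_C, h3, h4, smul_mul_assoc, monomial_mul_monomial, one_mul,
      Nat.sub_add_cancel (hd m hm), smul_monomial]
  rw [map_sum, Finset.sum_congr rfl hterm, ← map_sum]
  rw [MvPolynomial.aeval_def, MvPolynomial.eval₂_eq'] at hf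
  simp only [Algebra.smul_def]
  rw [hf, map_zero]

/-- **Noether normalization by linear forms.** -/
theorem exists_finrank_le_isReesIntegral {R : Type*} [CommRing R] [Nontrivial R] [Algebra ℂ R]
    {k : ℕ} (hk : ∀ n, k < n → ∀ u : Fin n → R,
      ∃ f : MvPolynomial (Fin n) ℂ, f ≠ 0 ∧ MvPolynomial.aeval u f = 0)
    (W : Submodule ℂ R) (hW : W.FG) :
    ∃ W' ≤ W, Module.finrank ℂ W' ≤ k ∧ IsReesIntegral (1 ⊔ W') (1 ⊔ W) := by
  induction h : Module.finrank ℂ W using Nat.strong_induction_on generalizing W with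
  | _ n ih =>
  have : Module.Finite ℂ W := Module.Finite.iff_fg.mpr hW
  rcases Nat.lt_or_ge k n with hn | hn
  · let e := Module.finBasisOfFinrankEq ℂ W h
    obtain ⟨f, hf0, hf⟩ := hk n hn fun i => (e i : R)
    obtain ⟨l, hl⟩ := exists_eval_homogeneousComponent_ne_zero hf0
    -- A homogeneous form that does not vanish at the origin has degree 0, so `f` would be a nonzero
    -- constant, which is no relation in a nontrivial ring.
    have hl0 : ∃ i, l i ≠ 0 := by
      by_contra! hl0
      obtain rfl : l = 0 := funext hl0
      have hd : f.totalDegree = 0 := by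
        by_contra hd
        apply hl
        rw [MvPolynomial.eval_zero, MvPolynomial.constantCoeff_eq,
          MvPolynomial.coeff_homogeneousComponent, if_neg]
        simpa using Ne.symm hd
      rw [MvPolynomial.totalDegree_eq_zero_iff_eq_C.mp hd] at hf hf0
      rw [MvPolynomial.algHom_C] at hf
      exact hf0 (by rw [(map_eq_zero_iff _ (algebraMap ℂ R).injective).mp hf, map_zero])
    obtain ⟨i₀, hi₀⟩ := hl0
    -- The hyperplane ker L contains every e i − l i • t once L t = 1, so `t` is integral over it
    -- and the dimension drops.
    let L : W →ₗ[ℂ] ℂ := e.constr ℂ l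
    have hL : ∀ i, L (e i) = l i := fun i => e.constr_basis ℂ l i
    let t : W := (l i₀)⁻¹ • e i₀
    have hLt : L t = 1 := by
      rw [map_smul, hL, smul_eq_mul, inv_mul_cancel₀ hi₀]
    let W' : Submodule ℂ R := (LinearMap.ker L).map W.subtype
    have hW'W : W' ≤ W := Submodule.map_subtype_le _ _
    have ht : (t : R) ∉ W' := by
      rintro ⟨s, hs, hst⟩
      obtain rfl : s = t := Subtype.ext hst
      rw [SetLike.mem_coe, LinearMap.mem_ker, hLt] at hs
      exact one_ne_zero hs
    have hlt : Module.finrank ℂ W' < n := by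
      rw [← h]
      exact Submodule.finrank_lt_finrank_of_lt (lt_of_le_of_ne hW'W fun heq => ht (heq.ge t.2))
    have hmem : ∀ w : W, (w : R) - L w • (t : R) ∈ W' := fun w =>
      ⟨w - L w • t, by simp [hLt], rfl⟩
    have hint : IsReesIntegral (1 ⊔ W') (1 ⊔ W) := by
      have h1 : (1 : R) ∈ 1 ⊔ W' := Submodule.mem_sup_left (Submodule.one_le.mp le_rfl)
      refine IsReesIntegral.sup (isReesIntegral_of_le le_sup_left) ?_
      intro w hw
      have h2 : w = (w - L ⟨w, hw⟩ • (t : R)) + L ⟨w, hw⟩ • (t : R) := by rw [sub_add_cancel]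
      rw [h2, map_add]
      refine .add ?_ ?_
      · exact isReesIntegral_of_le le_rfl _ (Submodule.mem_sup_right (hmem ⟨w, hw⟩))
      · have h3 : IsIntegral (reesAlg (1 ⊔ W')) (monomial 1 (t : R)) :=
          isIntegral_of_relation h1 hf hl fun i =>
            Submodule.mem_sup_right (by simpa [hL] using hmem (e i))
        rw [← smul_monomial]
        exact h3.smul _
    have hFG : W'.FG := (IsNoetherian.noetherian (LinearMap.ker L)).map _
    obtain ⟨W'', hW'', hdim, hint'⟩ := ih _ hlt W' hFG rfl
    exact ⟨W'', hW''.trans hW'W, hdim, hint'.trans hint⟩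
  · exact ⟨W, le_rfl, h.trans_le hn, isReesIntegral_of_le le_rfl⟩

end LinearNoether

/-! ### Generic linear forms are compatible with the filtration -/

section Openness

variable {R : Type*} [CommRing R] [Algebra ℂ R]

theorem exists_eq_add_sum_of_mem_affineSpan_mul {κ : Type*} [Fintype κ] (t : κ → R)
    (N : Submodule ℂ R) {v : R} (hv : v ∈ affineSpan t * N) :
    ∃ w₀ ∈ N, ∃ w : κ → R, (∀ i, w i ∈ N) ∧ v = w₀ + ∑ i, t i * w i := by
  classical
  induction hv using Submodule.mul_induction_on' with
  | mem_mul_mem m hm n hn =>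
    induction hm using Submodule.span_induction with
    | mem m hm =>
      rcases hm with rfl | ⟨i, rfl⟩
      · exact ⟨n, hn, 0, fun _ => N.zero_mem, by simp⟩
      · refine ⟨0, N.zero_mem, Pi.single i n, fun j => ?_, ?_⟩
        · by_cases h : j = i
          · subst h; simpa using hn
          · simp [h]
        · rw [Finset.sum_eq_single i] <;> simp +contextual
    | zero => exact ⟨0, N.zero_mem, 0, fun _ => N.zero_mem, by simp⟩
    | add a b _ _ ha hb =>
      obtain ⟨w, hw, w', hw', h⟩ := ha
      obtain ⟨u, hu, u', hu', h'⟩ := hb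
      exact ⟨w + u, N.add_mem hw hu, w' + u', fun i => N.add_mem (hw' i) (hu' i), by
        simp only [add_mul, h, h', Pi.add_apply, mul_add, Finset.sum_add_distrib]; ring⟩
    | smul c a _ ha =>
      obtain ⟨w, hw, w', hw', h⟩ := ha
      exact ⟨c • w, N.smul_mem c hw, c • w', fun i => N.smul_mem c (hw' i), by
        simp only [smul_mul_assoc, h, Pi.smul_apply, mul_smul_comm, Finset.smul_sum, smul_add]⟩
  | add a _ b _ ha hb =>
    obtain ⟨w, hw, w', hw', h⟩ := ha
    obtain ⟨u, hu, u', hu', h'⟩ := hb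
    exact ⟨w + u, N.add_mem hw hu, w' + u', fun i => N.add_mem (hw' i) (hu' i), by
      simp only [h, h', Pi.add_apply, mul_add, Finset.sum_add_distrib]; ring⟩

/-- The linear forms in the family `x` with coefficient matrix `A`. -/
def linearForms {k : ℕ} {σ : Type*} [Fintype σ] (x : σ → R) (A : Matrix (Fin k) σ ℂ)
    (i : Fin k) : R :=
  ∑ j, A i j • x j

theorem linearForms_mem_affineSpan {k : ℕ} {σ : Type*} [Fintype σ] (x : σ → R)
    (A : Matrix (Fin k) σ ℂ) (i : Fin k) : linearForms x A i ∈ affineSpan x :=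
  Submodule.sum_mem _ fun j _ => Submodule.smul_mem _ _ (mem_affineSpan x j)

theorem map_linearForms {R' : Type*} [CommRing R'] [Algebra ℂ R'] (f : R →ₐ[ℂ] R') {k : ℕ}
    {σ : Type*} [Fintype σ] (x : σ → R) (A : Matrix (Fin k) σ ℂ) (i : Fin k) :
    f (linearForms x A i) = linearForms (fun j => f (x j)) A i := by
  simp [linearForms]

/-- Being a Noether normalization compatible with the filtration by degree is a Zariski open
condition on a system of linear forms. -/
theorem exists_isFilteredFinite_of_eval_ne_zero {k : ℕ} {σ : Type*} [Fintype σ] (x : σ → R)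
    (A₀ : Matrix (Fin k) σ ℂ) (h : IsFilteredFinite (linearForms x A₀) (affineSpan x)) :
    ∃ Q : MvPolynomial (Fin k × σ) ℂ, Q ≠ 0 ∧ ∀ A : Matrix (Fin k) σ ℂ,
      MvPolynomial.eval (fun ij => A ij.1 ij.2) Q ≠ 0 →
        IsFilteredFinite (linearForms x A) (affineSpan x) := by
  classical
  obtain ⟨E, hE⟩ := h
  set V := affineSpan x with hV
  have : Module.Finite ℂ ↥(V ^ (E + 1)) := Module.Finite.iff_fg.mpr ((fg_affineSpan x).pow _)
  let b := Module.finBasis ℂ ↥(V ^ (E + 1))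
  -- Write a basis of V^(E+1) in terms of the forms of `A₀`. Replacing these forms by those of `A`
  -- gives vectors depending polynomially on `A`; they still span wherever their determinant, which
  -- is 1 at `A₀`, is nonzero.
  choose w₀ hw₀ w hw hb using fun l =>
    exists_eq_add_sum_of_mem_affineSpan_mul _ _ (hE (b l).2)
  -- Extending the coordinate map to all of `R` lets the individual summands be expanded separately.
  obtain ⟨φ, hφ⟩ := b.equivFun.toLinearMap.exists_extend
  have hφ' : ∀ v : ↥(V ^ (E + 1)), φ v = b.equivFun v := fun v => LinearMap.congr_fun hφ v
  have hmem : ∀ {v}, v ∈ V → ∀ {u}, u ∈ V ^ E → v * u ∈ V ^ (E + 1) := fun hv _ hu => by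
    rw [pow_succ']
    exact Submodule.mul_mem_mul hv hu
  let c : Matrix (Fin k) σ ℂ → _ → R := fun A l => w₀ l + ∑ i, linearForms x A i * w l i
  have hc : ∀ A l, c A l ∈ V ^ (E + 1) := fun A l => Submodule.add_mem _
    (pow_mono_of_one_mem (one_mem_affineSpan x) (Nat.le_succ E) (hw₀ l))
    (Submodule.sum_mem _ fun i _ => hmem (linearForms_mem_affineSpan x A i) (hw l i))
  let M : Matrix (Fin _) (Fin _) (MvPolynomial (Fin k × σ) ℂ) := fun m l =>
    .C (φ (w₀ l) m) + ∑ i, ∑ j, .X (i, j) * .C (φ (x j * w l i) m)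
  have hM : ∀ A : Matrix (Fin k) σ ℂ, MvPolynomial.eval (fun ij => A ij.1 ij.2) M.det =
      b.det fun l => ⟨c A l, hc A l⟩ := by
    intro A
    rw [RingHom.map_det, Module.Basis.det_apply]
    congr 1
    ext m l
    rw [RingHom.mapMatrix_apply, Matrix.map_apply, Module.Basis.toMatrix_apply,
      ← b.equivFun_apply, ← hφ']
    simp [M, c, linearForms, Finset.sum_mul]
  refine ⟨M.det, fun h0 => ?_, fun A hA => ⟨E, ?_⟩⟩
  · have h1 := hM A₀
    have h2 : (fun l => ⟨c A₀ l, hc A₀ l⟩ : _ → ↥(V ^ (E + 1))) = b :=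
      funext fun l => Subtype.ext (hb l).symm
    rw [h0, map_zero, h2, b.det_self] at h1
    exact zero_ne_one h1
  · rw [hM] at hA
    have h1 := ((Module.Basis.is_basis_iff_det b).mpr (isUnit_iff_ne_zero.mpr hA)).2
    intro v hv
    have h2 : (⟨v, hv⟩ : ↥(V ^ (E + 1))) ∈ Submodule.span ℂ
        (Set.range fun l => (⟨c A l, hc A l⟩ : ↥(V ^ (E + 1)))) := h1 ▸ trivial
    have h3 := Submodule.mem_map_of_mem (f := (V ^ (E + 1)).subtype) h2
    rw [Submodule.map_span, ← Set.range_comp] at h3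
    refine Submodule.span_le.mpr ?_ h3
    rintro _ ⟨l, rfl⟩
    have h4 : ∀ {s}, s ∈ affineSpan (linearForms x A) → ∀ {u}, u ∈ V ^ E →
        s * u ∈ affineSpan (linearForms x A) * V ^ E := fun hs _ hu => Submodule.mul_mem_mul hs hu
    refine Submodule.add_mem _ ?_ (Submodule.sum_mem _ fun i _ => h4 (mem_affineSpan _ i) (hw l i))
    simpa using h4 (one_mem_affineSpan _) (hw₀ l)

theorem isReesIntegral_affineSpan_linearForms {k : ℕ} {σ : Type*} [Fintype σ] {x : σ → R}
    {A : Matrix (Fin k) σ ℂ} (h : IsFilteredFinite (linearForms x A) (affineSpan x)) :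
    IsReesIntegral (affineSpan (linearForms x A)) (affineSpan x) :=
  let ⟨_, hE⟩ := h
  isReesIntegral_of_pow_succ_le (fg_affineSpan x) hE

theorem IsReesIntegral.isFilteredFinite {κ σ : Type*} [Finite σ] {t : κ → R} {x : σ → R}
    (h : IsReesIntegral (affineSpan t) (affineSpan x)) (ht : ∀ i, t i ∈ affineSpan x) :
    IsFilteredFinite t (affineSpan x) :=
  h.exists_pow_succ_le (affineSpan_le _ (one_mem_affineSpan x) ht) (fg_affineSpan x)

/-- Generic systems of `k` linear forms are Noether normalizations compatible with the filtration
by degree, if more than `k` elements are always algebraically dependent. -/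
theorem exists_forall_isFilteredFinite [Nontrivial R] {k : ℕ} {σ : Type*} [Fintype σ] (x : σ → R)
    (hk : ∀ n, k < n → ∀ u : Fin n → R,
      ∃ f : MvPolynomial (Fin n) ℂ, f ≠ 0 ∧ MvPolynomial.aeval u f = 0) :
    ∃ Q : MvPolynomial (Fin k × σ) ℂ, Q ≠ 0 ∧ ∀ A : Matrix (Fin k) σ ℂ,
      MvPolynomial.eval (fun ij => A ij.1 ij.2) Q ≠ 0 →
        IsFilteredFinite (linearForms x A) (affineSpan x) := by
  obtain ⟨W, hW, hdim, hint⟩ := exists_finrank_le_isReesIntegral hk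
    (Submodule.span ℂ (Set.range x)) (Submodule.fg_span (Set.finite_range x))
  have : Module.Finite ℂ (Submodule.span ℂ (Set.range x)) := .span_of_finite ℂ (Set.finite_range x)
  have : Module.Finite ℂ W := Submodule.finiteDimensional_of_le hW
  let e := Module.finBasis ℂ W
  -- The normalizing space may have dimension less than `k`; the family is padded with zeros.
  let t : Fin k → R := fun i =>
    if h : (i : ℕ) < Module.finrank ℂ W then e ⟨i, h⟩ else 0
  have ht : ∀ i, t i ∈ W := fun i => by
    dsimp only [t]
    split_ifs
    · exact Subtype.property _
    · exact W.zero_mem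
  have hWt : W ≤ affineSpan t := by
    intro v hv
    have h1 := e.sum_repr ⟨v, hv⟩
    have h2 : v = ∑ i, e.repr ⟨v, hv⟩ i • (e i : R) := by
      have h3 := congrArg W.subtype h1
      rw [map_sum] at h3
      exact h3.symm
    rw [h2]
    refine Submodule.sum_mem _ fun i _ => Submodule.smul_mem _ _ ?_
    have h3 := mem_affineSpan t ⟨i, i.2.trans_le hdim⟩
    simpa [t] using h3
  choose A₀ hA₀ using fun i =>
    (Submodule.mem_span_range_iff_exists_fun ℂ).mp (hW (ht i))
  refine exists_isFilteredFinite_of_eval_ne_zero x A₀ ?_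
  have hA₀' : linearForms x A₀ = t := funext hA₀
  rw [hA₀']
  refine IsReesIntegral.isFilteredFinite (fun v hv => ?_) fun i => hA₀' ▸
    linearForms_mem_affineSpan x A₀ i
  refine (isReesIntegral_of_le (sup_le ?_ hWt)).trans hint v (?_ : v ∈ _)
  · exact Submodule.one_le.mpr (one_mem_affineSpan t)
  · exact affineSpan_le (V := 1 ⊔ Submodule.span ℂ (Set.range x)) _
      (Submodule.mem_sup_left (Submodule.one_le.mp le_rfl))
      (fun i => Submodule.mem_sup_right (Submodule.subset_span ⟨i, rfl⟩)) hv

end Openness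

/-! ### Coordinate rings and their points -/

section CoordinateRing

variable {σ : Type} (X : Set (σ → ℂ))

/-- The coordinate ring of `X ⊆ ℂ^σ`. -/
abbrev CoordRing : Type := MvPolynomial σ ℂ ⧸ MvPolynomial.vanishingIdeal ℂ X

/-- The coordinate functions on `X`. -/
noncomputable def coord (i : σ) : CoordRing X := Ideal.Quotient.mkₐ ℂ _ (MvPolynomial.X i)

variable {X}

theorem algHom_apply_mk {A : Type*} [CommRing A] [Algebra ℂ A] (z : CoordRing X →ₐ[ℂ] A)
    (p : MvPolynomial σ ℂ) :
    z (Ideal.Quotient.mkₐ ℂ _ p) = MvPolynomial.aeval (fun i => z (coord X i)) p := by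
  have h : z.comp (Ideal.Quotient.mkₐ ℂ _) = MvPolynomial.aeval (fun i => z (coord X i)) :=
    MvPolynomial.algHom_ext fun i => by simp [coord]
  exact DFunLike.congr_fun h p

theorem coordRing_algHom_ext {A : Type*} [CommRing A] [Algebra ℂ A] {z z' : CoordRing X →ₐ[ℂ] A}
    (h : ∀ i, z (coord X i) = z' (coord X i)) : z = z' :=
  Ideal.Quotient.algHom_ext _ (MvPolynomial.algHom_ext h)

variable (X) in
theorem adjoin_range_coord : Algebra.adjoin ℂ (Set.range (coord X)) = ⊤ := by
  have h := congrArg (Subalgebra.map (Ideal.Quotient.mkₐ ℂ (MvPolynomial.vanishingIdeal ℂ X)))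
    (MvPolynomial.adjoin_range_X (R := ℂ) (σ := σ))
  rw [AlgHom.map_adjoin, ← Set.range_comp, Algebra.map_top,
    (AlgHom.range_eq_top _).mpr (Ideal.Quotient.mkₐ_surjective ℂ _)] at h
  exact h

/-- Elements of an algebra that satisfy the equations of `X` define a homomorphism from the
coordinate ring of `X`. -/
theorem exists_algHom_coordRing {A : Type*} [CommRing A] [Algebra ℂ A] (a : σ → A)
    (h : ∀ p ∈ MvPolynomial.vanishingIdeal ℂ X, MvPolynomial.aeval a p = 0) :
    ∃ φ : CoordRing X →ₐ[ℂ] A, ∀ i, φ (coord X i) = a i :=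
  ⟨Ideal.Quotient.liftₐ _ (MvPolynomial.aeval a) h, fun i => MvPolynomial.aeval_X a i⟩

theorem exists_algHom_of_mem {x : σ → ℂ} (hx : x ∈ X) :
    ∃ z : CoordRing X →ₐ[ℂ] ℂ, ∀ i, z (coord X i) = x i :=
  exists_algHom_coordRing x fun _ hp => hp x hx

theorem IsAlgebraicSet.mem_of_algHom (hX : IsAlgebraicSet X) (z : CoordRing X →ₐ[ℂ] ℂ) :
    (fun i => z (coord X i)) ∈ X := by
  obtain ⟨I, rfl⟩ := hX
  intro p hp
  rw [← algHom_apply_mk, Ideal.Quotient.mkₐ_eq_mk, Ideal.Quotient.eq_zero_iff_mem.mpr, map_zero]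
  exact fun x hx => hx p hp

/-- Immediate from dividing by the full vanishing ideal; neither the Nullstellensatz nor
algebraicity of `X` is needed. -/
theorem eq_zero_of_forall_algHom {r : CoordRing X} (h : ∀ z : CoordRing X →ₐ[ℂ] ℂ, z r = 0) :
    r = 0 := by
  obtain ⟨p, rfl⟩ := Ideal.Quotient.mkₐ_surjective ℂ _ r
  refine Ideal.Quotient.eq_zero_iff_mem.mpr fun x hx => ?_
  obtain ⟨z, hz⟩ := exists_algHom_of_mem hx
  have h1 := h z
  rwa [algHom_apply_mk, funext hz] at h1

instance : IsReduced (CoordRing X) :=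
  ⟨fun r ⟨n, hn⟩ => eq_zero_of_forall_algHom fun z =>
    eq_zero_of_pow_eq_zero (n := n) (by rw [← map_pow, hn, map_zero])⟩

theorem nontrivial_coordRing (h : X.Nonempty) : Nontrivial (CoordRing X) :=
  let ⟨_, hx⟩ := h
  let ⟨z, _⟩ := exists_algHom_of_mem hx
  z.toRingHom.domain_nontrivial

end CoordinateRing

/-! ### Existence of the degree -/

section Existence

variable {σ : Type} [Fintype σ] {X : Set (σ → ℂ)}

/-- Adjoining the variables `κ` to `R` raises the number of elements over which it is integral by
exactly |κ|, which is the count needed for `exists_relation`. -/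
theorem isIntegral_adjoin_sumElim {κ ι R : Type} [CommRing R] [Algebra ℂ R] (y : ι → R)
    [Algebra.IsIntegral (Algebra.adjoin ℂ (Set.range y)) R] :
    Algebra.IsIntegral (Algebra.adjoin ℂ (Set.range
      (Sum.elim MvPolynomial.X (fun i => MvPolynomial.C (y i)) : κ ⊕ ι → MvPolynomial κ R)))
      (MvPolynomial κ R) := by
  set A := Algebra.adjoin ℂ (Set.range
      (Sum.elim MvPolynomial.X (fun i => MvPolynomial.C (y i)) : κ ⊕ ι → MvPolynomial κ R)) with hA
  have hX : ∀ s, Sum.elim MvPolynomial.X (fun i => MvPolynomial.C (y i)) s ∈ A := fun s =>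
    Algebra.subset_adjoin ⟨s, rfl⟩
  refine ⟨fun p => ?_⟩
  induction p using MvPolynomial.induction_on with
  | C r =>
    have h1 := isIntegral_map_subalgebra (IsScalarTower.toAlgHom ℂ R (MvPolynomial κ R))
      (Algebra.IsIntegral.isIntegral (R := Algebra.adjoin ℂ (Set.range y)) r)
    rw [AlgHom.map_adjoin] at h1
    have hle : Algebra.adjoin ℂ ((IsScalarTower.toAlgHom ℂ R (MvPolynomial κ R)) '' Set.range y)
        ≤ A := by
      refine Algebra.adjoin_le ?_
      rintro _ ⟨_, ⟨i, rfl⟩, rfl⟩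
      exact hX (.inr i)
    exact h1.map_of_comp_eq (φ := (Subalgebra.inclusion hle).toRingHom) (ψ := RingHom.id _) rfl
  | add p q hp hq => exact hp.add hq
  | mul_X p i hp => exact hp.mul (isIntegral_algebraMap (x := (⟨_, hX (.inl i)⟩ : A)))

/-- An element that satisfies a relation over the images of the variables is algebraic. -/
theorem isAlgebraic_of_relation {ι B : Type*} [CommRing B] [Algebra ℂ B]
    [Algebra (MvPolynomial ι ℂ) B] [IsScalarTower ℂ (MvPolynomial ι ℂ) B] (x : B)
    {f : MvPolynomial (Option ι) ℂ} (hf0 : f ≠ 0)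
    (hf : MvPolynomial.aeval (fun o : Option ι =>
      o.elim x fun i => algebraMap (MvPolynomial ι ℂ) B (.X i)) f = 0) :
    IsAlgebraic (MvPolynomial ι ℂ) x := by
  refine ⟨MvPolynomial.optionEquivLeft ℂ ι f, by simpa using hf0, ?_⟩
  have h : ((Polynomial.aeval (R := MvPolynomial ι ℂ) x).restrictScalars ℂ).comp
      (MvPolynomial.optionEquivLeft ℂ ι).toAlgHom = MvPolynomial.aeval (fun o : Option ι =>
      o.elim x fun i => algebraMap (MvPolynomial ι ℂ) B (.X i)) := by
    refine MvPolynomial.algHom_ext fun o => ?_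
    cases o <;> simp
  rw [← hf, ← h]
  rfl

/-- The degree of an affine algebraic set exists. -/
theorem IsAlgebraicSet.exists_hasDegree (hX : IsAlgebraicSet X) (hne : X.Nonempty) :
    ∃ d, HasDegree X d := by
  have := nontrivial_coordRing hne
  obtain ⟨k, y, hk, hy⟩ := exists_ringKrullDim_eq (CoordRing X)
  -- The universal linear section {(A, b, x) : x ∈ X, A x = b} over the space of systems (A, b). As
  -- b is determined by A and x, its ring is the polynomial ring in the entries of A over the
  -- coordinate ring of X.
  let S := MvPolynomial ((Fin k × σ) ⊕ Fin k) ℂ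
  let B := MvPolynomial (Fin k × σ) (CoordRing X)
  let w : (Fin k × σ) ⊕ Fin k → B :=
    Sum.elim .X fun i => ∑ j, .X (i, j) * .C (coord X j)
  let φ : S →ₐ[ℂ] B := MvPolynomial.aeval w
  let _ : Algebra S B := φ.toRingHom.toAlgebra
  have : IsScalarTower ℂ S B := .of_algebraMap_eq fun r => (φ.commutes r).symm
  have hw : ∀ i, algebraMap S B (.X i) = w i := fun i => MvPolynomial.aeval_X w i
  classical
  let T : Finset B := Finset.univ.image fun j => .C (coord X j)
  have hT : Algebra.adjoin S (T : Set B) = ⊤ := by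
    refine eq_top_iff.mpr fun p _ => ?_
    induction p using MvPolynomial.induction_on with
    | C r =>
      have h1 : r ∈ Algebra.adjoin ℂ (Set.range (coord X)) := adjoin_range_coord X ▸ trivial
      induction h1 using Algebra.adjoin_induction with
      | mem r hr =>
        obtain ⟨j, rfl⟩ := hr
        exact Algebra.subset_adjoin (by simp [T])
      | algebraMap c =>
        have h2 : (.C (algebraMap ℂ (CoordRing X) c) : B) = algebraMap S B (algebraMap ℂ S c) := by
          rw [← IsScalarTower.algebraMap_apply]
          rfl
        rw [h2]
        exact Subalgebra.algebraMap_mem _ _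
      | add a b _ _ ha hb => rw [map_add]; exact add_mem (ha trivial) (hb trivial)
      | mul a b _ _ ha hb => rw [map_mul]; exact mul_mem (ha trivial) (hb trivial)
    | add p q hp hq => exact add_mem (hp trivial) (hq trivial)
    | mul_X p i hp =>
      refine mul_mem (hp trivial) ?_
      have h2 := Subalgebra.algebraMap_mem (Algebra.adjoin S (T : Set B)) (.X (.inl i))
      rwa [hw] at h2
  have halg : ∀ t ∈ T, IsAlgebraic S t := by
    intro t _
    have := isIntegral_adjoin_sumElim (κ := Fin k × σ) y
    -- Base and total space have the same dimension, so adding `t` to the coordinates of the base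
    -- gives one element too many.
    obtain ⟨f, hf0, hf⟩ := exists_relation
      (Sum.elim .X (fun i => .C (y i)) : (Fin k × σ) ⊕ Fin k → B)
      (fun o : Option ((Fin k × σ) ⊕ Fin k) => o.elim t fun i => algebraMap S B (.X i))
      (by simp)
    exact isAlgebraic_of_relation t hf0 hf
  obtain ⟨d, P, hP0, hP⟩ : ∃ d, HasGenericFiberCard S B d :=
    ⟨_, hasGenericFiberCard_finrank T hT halg⟩
  refine ⟨d, k, hk, P, hP0, fun A b hAb => ?_⟩
  let q : S →ₐ[ℂ] ℂ := MvPolynomial.aeval (Sum.elim (fun ij => A ij.1 ij.2) b)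
  have h1 := hP q hAb
  rw [← h1]
  have hinj : Set.InjOn (fun (z : B →ₐ[ℂ] ℂ) j => z (.C (coord X j))) (pointsOver B q) := by
    intro z hz z' hz' h
    have h2 : z.comp (IsScalarTower.toAlgHom ℂ (CoordRing X) B) =
        z'.comp (IsScalarTower.toAlgHom ℂ (CoordRing X) B) :=
      coordRing_algHom_ext fun j => congrFun h j
    refine MvPolynomial.algHom_ext' h2 fun ij => ?_
    have h3 := (hz (.X (.inl ij))).trans (hz' (.X (.inl ij))).symm
    rwa [hw] at h3
  rw [← hinj.encard_image]
  congr 1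
  ext x
  have hq : ∀ i, q (.X i) = Sum.elim (fun ij => A ij.1 ij.2) b i := fun i =>
    MvPolynomial.aeval_X _ i
  constructor
  · rintro ⟨hx, hxA⟩
    obtain ⟨z, hz⟩ := exists_algHom_of_mem hx
    let z' : B →ₐ[ℂ] ℂ := MvPolynomial.aevalTower z fun ij => A ij.1 ij.2
    have hzC : ∀ j, z' (.C (coord X j)) = x j := fun j =>
      (MvPolynomial.aevalTower_C _ _ _).trans (hz j)
    have hzX : ∀ ij, z' (.X ij) = A ij.1 ij.2 := fun ij => MvPolynomial.aevalTower_X _ _ _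
    refine ⟨z', fun s => ?_, funext hzC⟩
    have h2 : z'.comp φ = q := by
      refine MvPolynomial.algHom_ext fun i => ?_
      rw [hq]
      change z' (φ (.X i)) = _
      rw [show φ (.X i) = w i from hw i]
      rcases i with ij | i
      · exact hzX ij
      · simp only [w, Sum.elim_inr, map_sum, map_mul, hzC, hzX]
        exact congrFun hxA i
    exact DFunLike.congr_fun h2 s
  · rintro ⟨z, hz, rfl⟩
    refine ⟨hX.mem_of_algHom (z.comp (IsScalarTower.toAlgHom ℂ (CoordRing X) B)), ?_⟩
    have hzX : ∀ i, z (w i) = Sum.elim (fun ij => A ij.1 ij.2) b i := fun i => by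
      rw [← hw, hz, hq]
    ext i
    have h2 := hzX (.inr i)
    simp only [w, Sum.elim_inr, map_sum, map_mul] at h2
    rw [← h2]
    refine Finset.sum_congr rfl fun j _ => ?_
    congr 1
    exact (hzX (.inl (i, j))).symm

end Existence

/-! ### From growth to integrality, and from rank to degree -/

section Transfer

open Polynomial in
-- Set the Rees variable equal to 1.
theorem IsReesIntegral.isIntegral {R : Type*} [CommRing R] [Algebra ℂ R] {U V : Submodule ℂ R}
    (h : IsReesIntegral U V) {v : R} (hv : v ∈ V) :
    IsIntegral (Algebra.adjoin ℂ (U : Set R)) v := by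
  have h1 := isIntegral_map_subalgebra ((aeval (R := R) (1 : R)).restrictScalars ℂ) (h v hv)
  have h2 : (reesAlg U).map ((aeval (R := R) (1 : R)).restrictScalars ℂ) =
      Algebra.adjoin ℂ (U : Set R) := by
    rw [reesAlg, AlgHom.map_adjoin, Set.image_image]
    simp
  rw [h2] at h1
  simpa using h1

theorem adjoin_affineSpan {σ R : Type*} [CommRing R] [Algebra ℂ R] (x : σ → R) :
    Algebra.adjoin ℂ (affineSpan x : Set R) = Algebra.adjoin ℂ (Set.range x) := by
  refine le_antisymm (Algebra.adjoin_le ?_) (Algebra.adjoin_mono ?_)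
  · exact affineSpan_le (V := (Algebra.adjoin ℂ (Set.range x)).toSubmodule) x (Subalgebra.one_mem _)
      fun i => Algebra.subset_adjoin ⟨i, rfl⟩
  · rintro _ ⟨i, rfl⟩
    exact mem_affineSpan x i

theorem IsReesIntegral.algebra_isIntegral {σ ι R : Type*} [CommRing R] [Algebra ℂ R] {u : σ → R}
    {w : ι → R} (h : IsReesIntegral (affineSpan u) (affineSpan w))
    (hw : Algebra.adjoin ℂ (Set.range w) = ⊤) :
    Algebra.IsIntegral (Algebra.adjoin ℂ (Set.range u)) R := by
  refine ⟨fun r => ?_⟩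
  have hr : r ∈ Algebra.adjoin ℂ (Set.range w) := hw ▸ trivial
  induction hr using Algebra.adjoin_induction with
  | mem r hr =>
    obtain ⟨i, rfl⟩ := hr
    have h1 := h.isIntegral (mem_affineSpan w i)
    rwa [adjoin_affineSpan] at h1
  | algebraMap c =>
    rw [IsScalarTower.algebraMap_apply ℂ (Algebra.adjoin ℂ (Set.range u)) R]
    exact isIntegral_algebraMap
  | add a b _ _ ha hb => exact ha.add hb
  | mul a b _ _ ha hb => exact ha.mul hb

open Polynomial in
/-- A family of linear growth over another one is integral over it in the Rees algebra. -/
theorem isReesIntegral_of_norm_le {σ κ B : Type*} [Fintype σ] [CommRing B] [Algebra ℂ B]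
    [Algebra.FiniteType ℂ B] (u : σ → B) (v : κ → B) {K D : ℝ} (hK : 0 ≤ K)
    (h : ∀ (z : B →ₐ[ℂ] ℂ) j, ‖z (v j)‖ ≤ K * ‖fun i => z (u i)‖ + D) :
    IsReesIntegral (affineSpan u) (affineSpan v) := by
  let g : Option σ → B[X] := fun o => o.elim (monomial 1 1) fun i => monomial 1 (u i)
  have hg : Algebra.adjoin ℂ (Set.range g) ≤ reesAlg (affineSpan u) := by
    refine Algebra.adjoin_le ?_
    rintro _ ⟨_ | i, rfl⟩
    · exact monomial_one_mem_reesAlg (one_mem_affineSpan u)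
    · exact monomial_one_mem_reesAlg (mem_affineSpan u i)
  refine isReesIntegral_span ?_
  rintro _ (rfl | ⟨j, rfl⟩)
  · exact isReesIntegral_of_le le_rfl _ (one_mem_affineSpan u)
  have h1 : IsIntegral (Algebra.adjoin ℂ (Set.range g)) (monomial 1 (v j) : B[X]) := by
    refine isIntegral_of_bounded g _ fun r => ⟨K * r + |D| * r, fun z hz => ?_⟩
    -- A point of `B[X]` is a point `z₀` of `B` together with a scalar τ. Bounds on τ and on the
    -- τ·u_i give |τ·v_j| ≤ K r + |D| r, including when τ = 0.
    let z₀ : B →ₐ[ℂ] ℂ := z.comp (IsScalarTower.toAlgHom ℂ B B[X])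
    have hm : ∀ b, z (monomial 1 b) = z (monomial 1 1) * z₀ b := fun b => by
      change _ = _ * z (C b)
      rw [← map_mul, monomial_mul_C, one_mul]
    have hr : 0 ≤ r := (norm_nonneg _).trans (hz none)
    have h2 : ‖z (monomial 1 1)‖ * ‖fun i => z₀ (u i)‖ ≤ r := by
      rw [← norm_smul, pi_norm_le_iff_of_nonneg hr]
      intro i
      rw [Pi.smul_apply, smul_eq_mul, ← hm]
      exact hz (some i)
    have h3 : ‖z (monomial 1 1)‖ ≤ r := hz none
    have h4 : ‖z₀ (v j)‖ ≤ K * ‖fun i => z₀ (u i)‖ + |D| :=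
      (h z₀ j).trans (by gcongr; exact le_abs_self D)
    rw [hm, norm_mul]
    calc ‖z (monomial 1 1)‖ * ‖z₀ (v j)‖
        ≤ ‖z (monomial 1 1)‖ * (K * ‖fun i => z₀ (u i)‖ + |D|) := by gcongr
      _ = K * (‖z (monomial 1 1)‖ * ‖fun i => z₀ (u i)‖) + |D| * ‖z (monomial 1 1)‖ := by ring
      _ ≤ K * r + |D| * r := by gcongr
  exact h1.map_of_comp_eq (φ := (Subalgebra.inclusion hg).toRingHom) (ψ := RingHom.id _) rfl

theorem isIntegralElem_of_le_range {S R : Type*} [CommRing S] [CommRing R] [Algebra ℂ S]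
    [Algebra ℂ R] {A : Subalgebra ℂ R} {φ : S →ₐ[ℂ] R} (h : A ≤ φ.range) {r : R}
    (hr : IsIntegral A r) : φ.toRingHom.IsIntegralElem r := by
  have hr' : IsIntegral φ.range r :=
    hr.map_of_comp_eq (φ := (Subalgebra.inclusion h).toRingHom) (ψ := RingHom.id _) rfl
  obtain ⟨p, hp, hpr⟩ := hr'
  have hlift : p ∈ Polynomial.lifts φ.rangeRestrict.toRingHom := by
    rw [Polynomial.lifts_iff_coeff_lifts]
    exact fun n => φ.rangeRestrict_surjective (p.coeff n)
  obtain ⟨q, hq, -, hqm⟩ := Polynomial.lifts_and_natDegree_eq_and_monic hlift hp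
  refine ⟨q, hqm, ?_⟩
  rw [← hpr, ← hq, Polynomial.eval₂_map]
  rfl

/-- The rank over a finite polynomial subalgebra is the cardinality of the generic fiber. -/
theorem rankOver_eq {k d : ℕ} {R : Type} [CommRing R] [Algebra ℂ R] [Algebra.FiniteType ℂ R]
    [IsReduced R] (t : Fin k → R) (ht : Algebra.IsIntegral (Algebra.adjoin ℂ (Set.range t)) R)
    {P : MvPolynomial (Fin k) ℂ} (hP : P ≠ 0) (h : ∀ b, MvPolynomial.eval b P ≠ 0 →
      {z : R →ₐ[ℂ] ℂ | ∀ i, z (t i) = b i}.encard = d) : rankOver t = d := by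
  let S := MvPolynomial (Fin k) ℂ
  let _ : Algebra S R := (MvPolynomial.aeval t).toRingHom.toAlgebra
  have : IsScalarTower ℂ S R := .of_algebraMap_eq' (MvPolynomial.aeval t).comp_algebraMap.symm
  have hX : ∀ i, algebraMap S R (.X i) = t i := MvPolynomial.aeval_X t
  have hS : Algebra.IsIntegral S R := by
    exact ⟨fun r => isIntegralElem_of_le_range
      (Algebra.adjoin_range_eq_range_aeval ℂ t).le (ht.isIntegral r)⟩
  have : Algebra.FiniteType S R := .of_restrictScalars_finiteType ℂ S R
  have : Module.Finite S R := Algebra.IsIntegral.finite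
  obtain ⟨P', hP', hcard⟩ := hasGenericFiberCard_of_finite (S := S) (B := R)
  -- At a common good point the assumed count and the rank count the same fibre.
  obtain ⟨b, hb⟩ : ∃ b, MvPolynomial.eval b (P * P') ≠ 0 := by
    by_contra! hb
    exact mul_ne_zero hP hP' (MvPolynomial.funext fun b => by simpa using hb b)
  rw [map_mul] at hb
  have h1 := hcard (MvPolynomial.aeval b) (right_ne_zero_of_mul hb)
  have h2 : pointsOver R (MvPolynomial.aeval b : S →ₐ[ℂ] ℂ) =
      {z : R →ₐ[ℂ] ℂ | ∀ i, z (t i) = b i} := by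
    ext z
    constructor
    · intro hz i
      rw [← hX, hz, MvPolynomial.aeval_X]
    · intro hz s
      have h3 : z.comp (IsScalarTower.toAlgHom ℂ S R) = MvPolynomial.aeval b :=
        MvPolynomial.algHom_ext fun i => by
          rw [MvPolynomial.aeval_X, ← hz i, ← hX]
          rfl
      exact DFunLike.congr_fun h3 s
  rw [h2, h b (left_ne_zero_of_mul hb)] at h1
  exact_mod_cast h1.symm

section

variable {σ τ : Type} {X : Set (σ → ℂ)} {G : Set (τ → ℂ)}

/-- Pullback of functions along the bijection from the points of `G` to `X` is injective because
that map is onto, and it is integral by `hint`. -/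
theorem dimension_eq (u : σ → CoordRing G)
    (hu : Set.BijOn (fun (z : CoordRing G →ₐ[ℂ] ℂ) i => z (u i)) Set.univ X)
    (hint : Algebra.IsIntegral (Algebra.adjoin ℂ (Set.range u)) (CoordRing G)) :
    dimension X = ringKrullDim (CoordRing G) := by
  have hz : ∀ (z : CoordRing G →ₐ[ℂ] ℂ) p, z (MvPolynomial.aeval u p) =
      MvPolynomial.aeval (fun i => z (u i)) p := fun z p =>
    DFunLike.congr_fun (MvPolynomial.comp_aeval u z) p
  obtain ⟨φ, hφ⟩ := exists_algHom_coordRing (X := X) u fun p hp =>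
    eq_zero_of_forall_algHom fun z => by
      rw [hz]
      exact hp _ (hu.mapsTo (Set.mem_univ z))
  let _ := φ.toRingHom.toAlgebra
  have hle : Algebra.adjoin ℂ (Set.range u) ≤ φ.range := by
    refine Algebra.adjoin_le ?_
    rintro _ ⟨i, rfl⟩
    exact ⟨_, hφ i⟩
  have hinj : Function.Injective φ := by
    rw [injective_iff_map_eq_zero]
    intro r hr
    obtain ⟨p, rfl⟩ := Ideal.Quotient.mkₐ_surjective ℂ _ r
    refine Ideal.Quotient.eq_zero_iff_mem.mpr fun x hx => ?_
    obtain ⟨z, -, rfl⟩ := hu.surjOn hx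
    rw [algHom_apply_mk, funext hφ] at hr
    rw [← hz, hr, map_zero]
  have : Algebra.IsIntegral (CoordRing X) (CoordRing G) :=
    ⟨fun r => isIntegralElem_of_le_range hle (hint.isIntegral r)⟩
  exact ringKrullDim_eq_of_isIntegral hinj

/-- The degree of `X` as the rank of the coordinate ring of `G`, finite over `X`, over a Noether
normalization by linear forms on `X`. -/
theorem exists_rankOver_eq {ι : Type} [Fintype σ] [Finite τ] [Finite ι] (hG : G.Nonempty)
    (u : σ → CoordRing G)
    (w : ι → CoordRing G) (huw : ∀ i, u i ∈ affineSpan w)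
    (hw : Algebra.adjoin ℂ (Set.range w) = ⊤)
    (hint : IsReesIntegral (affineSpan u) (affineSpan w))
    (hu : Set.BijOn (fun (z : CoordRing G →ₐ[ℂ] ℂ) i => z (u i)) Set.univ X) {k d : ℕ}
    (hk : ringKrullDim (CoordRing G) = k) (hd : HasDegree X d) :
    ∃ t : Fin k → CoordRing G, (∀ i, t i ∈ affineSpan w) ∧ IsFilteredFinite t (affineSpan w) ∧
      rankOver t = d := by
  have := nontrivial_coordRing hG
  obtain ⟨l, hl, P, hP, hPd⟩ := hd
  rw [dimension_eq u hu (hint.algebra_isIntegral hw), hk] at hl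
  obtain rfl : k = l := by exact_mod_cast hl
  obtain ⟨k', y, hk', hy⟩ := exists_ringKrullDim_eq (CoordRing G)
  obtain rfl : k = k' := by
    rw [hk] at hk'
    exact_mod_cast hk'
  obtain ⟨Q, hQ, hQA⟩ := exists_forall_isFilteredFinite u fun n hn v =>
    exists_relation y v (by simpa using hn)
  -- One matrix must be good both for counting points and for normalizing. The second condition does
  -- not involve `b`, hence the renaming.
  obtain ⟨v, hv⟩ : ∃ v, MvPolynomial.eval v (P * MvPolynomial.rename Sum.inl Q) ≠ 0 := by
    by_contra! h
    refine mul_ne_zero hP ?_ (MvPolynomial.funext fun v => by simpa using h v)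
    rwa [Ne, map_eq_zero_iff _ (MvPolynomial.rename_injective _ Sum.inl_injective)]
  rw [map_mul, MvPolynomial.eval_rename] at hv
  let A : Matrix (Fin k) σ ℂ := fun i j => v (.inl (i, j))
  have hA := hQA A (right_ne_zero_of_mul hv)
  have hAw := (isReesIntegral_affineSpan_linearForms hA).trans hint
  have ht : ∀ i, linearForms u A i ∈ affineSpan w := fun i =>
    affineSpan_le u (one_mem_affineSpan w) huw (linearForms_mem_affineSpan u A i)
  refine ⟨linearForms u A, ht, hAw.isFilteredFinite ht, ?_⟩
  -- The genericity condition with the matrix frozen. It is not identically zero, since it is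
  -- nonzero at the `b` part of `v`.
  let PA : MvPolynomial (Fin k) ℂ :=
    MvPolynomial.aeval (Sum.elim (fun ij => .C (A ij.1 ij.2)) .X) P
  have hPA : ∀ b, MvPolynomial.eval b PA =
      MvPolynomial.eval (Sum.elim (fun ij => A ij.1 ij.2) b) P := by
    intro b
    have h1 : (MvPolynomial.aeval b : MvPolynomial (Fin k) ℂ →ₐ[ℂ] ℂ).comp
        (MvPolynomial.aeval (Sum.elim (fun ij => .C (A ij.1 ij.2)) .X)) =
        (MvPolynomial.aeval (Sum.elim (fun ij => A ij.1 ij.2) b) :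
          MvPolynomial ((Fin k × σ) ⊕ Fin k) ℂ →ₐ[ℂ] ℂ) := by
      refine MvPolynomial.algHom_ext fun s => ?_
      rcases s with s | s <;> simp
    exact DFunLike.congr_fun h1 P
  refine rankOver_eq _ (hAw.algebra_isIntegral hw) (P := PA) (fun h0 => ?_) fun b hb => ?_
  · refine left_ne_zero_of_mul hv ?_
    have h1 := hPA fun i => v (.inr i)
    rw [h0, map_zero] at h1
    have h2 : v = Sum.elim (fun ij => A ij.1 ij.2) fun i => v (.inr i) := by
      ext (s | s) <;> rfl
    exact (congrArg (fun v => MvPolynomial.eval v P) h2).trans h1.symm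
  · rw [hPA] at hb
    rw [← hPd A b hb, ← (hu.injOn.mono (Set.subset_univ _)).encard_image]
    congr 1
    ext x
    constructor
    · rintro ⟨z, hz, rfl⟩
      refine ⟨hu.mapsTo (Set.mem_univ z), funext fun i => ?_⟩
      rw [← hz i, map_linearForms]
      rfl
    · rintro ⟨hx, hxA⟩
      obtain ⟨z, -, rfl⟩ := hu.surjOn hx
      refine ⟨z, fun i => ?_, rfl⟩
      rw [map_linearForms]
      exact congrFun hxA i

end

end Transfer

/-! ### Linear growth of Lipschitz maps -/

section BiLipschitz

/-- Compare with a fixed base point. This affine growth bound is all that the metric hypothesis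
contributes. -/
theorem exists_norm_le_of_lipschitz {E F : Type*} [SeminormedAddCommGroup E]
    [SeminormedAddCommGroup F] {T : Type*} [Nonempty T] {a : T → E} {b : T → F} {K : ℝ}
    (h : ∀ s t, dist (b s) (b t) ≤ K * dist (a s) (a t)) (hK : 0 ≤ K) :
    ∃ D : ℝ, ∀ s, ‖b s‖ ≤ K * ‖a s‖ + D := by
  obtain ⟨t⟩ := ‹Nonempty T›
  refine ⟨K * ‖a t‖ + ‖b t‖, fun s => ?_⟩
  have h1 := h s t
  rw [dist_eq_norm, dist_eq_norm] at h1
  have h2 : ‖b s‖ ≤ ‖b s - b t‖ + ‖b t‖ := by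
    simpa using norm_add_le (b s - b t) (b t)
  have h3 := mul_le_mul_of_nonneg_left (norm_sub_le (a s) (a t)) hK
  linarith

theorem isReesIntegral_sumElim {σ τ B : Type*} [CommRing B] [Algebra ℂ B] {u : σ → B} {v : τ → B}
    (h : IsReesIntegral (affineSpan u) (affineSpan v)) :
    IsReesIntegral (affineSpan u) (affineSpan (Sum.elim u v)) := by
  refine fun x hx => (isReesIntegral_of_le le_rfl).sup h x (affineSpan_le _ ?_ ?_ hx)
  · exact Submodule.mem_sup_left (one_mem_affineSpan u)
  · rintro (i | j)
    · exact Submodule.mem_sup_left (mem_affineSpan u i)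
    · exact Submodule.mem_sup_right (mem_affineSpan v j)

end BiLipschitz

/-! ### The graph and the comparison of degrees -/

section Graph

variable {σ τ : Type} {X : Set (σ → ℂ)} {Y : Set (τ → ℂ)}

/-- The first coordinate functions on a graph. -/
noncomputable def coordLeft (f : X → Y) (i : σ) : CoordRing (graph f) := coord _ (.inl i)

/-- The second coordinate functions on a graph. -/
noncomputable def coordRight (f : X → Y) (j : τ) : CoordRing (graph f) := coord _ (.inr j)

theorem coord_graph (f : X → Y) : coord (graph f) = Sum.elim (coordLeft f) (coordRight f) := by
  ext (i | j) <;> rfl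

theorem coordLeft_mem_affineSpan (f : X → Y) (i : σ) :
    coordLeft f i ∈ affineSpan (coord (graph f)) :=
  mem_affineSpan (coord (graph f)) (.inl i)

theorem coordRight_mem_affineSpan (f : X → Y) (j : τ) :
    coordRight f j ∈ affineSpan (coord (graph f)) :=
  mem_affineSpan (coord (graph f)) (.inr j)

theorem exists_apply_coordLeft_eq {f : X → Y} (hf : IsAlgebraicSet (graph f))
    (z : CoordRing (graph f) →ₐ[ℂ] ℂ) :
    ∃ x : X, (fun i => z (coordLeft f i)) = x ∧ (fun j => z (coordRight f j)) = f x := by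
  obtain ⟨x, hx⟩ := hf.mem_of_algHom z
  exact ⟨x, funext fun i => congrFun hx (.inl i), funext fun j => congrFun hx (.inr j)⟩

theorem exists_algHom_coordLeft_eq (f : X → Y) (x : X) : ∃ z : CoordRing (graph f) →ₐ[ℂ] ℂ,
    (fun i => z (coordLeft f i)) = x ∧ (fun j => z (coordRight f j)) = f x := by
  obtain ⟨z, hz⟩ := exists_algHom_of_mem (X := graph f) ⟨x, rfl⟩
  exact ⟨z, funext fun i => hz (.inl i), funext fun j => hz (.inr j)⟩

theorem algHom_graph_ext {f : X → Y} {z z' : CoordRing (graph f) →ₐ[ℂ] ℂ}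
    (h : (fun i => z (coordLeft f i)) = fun i => z' (coordLeft f i))
    (h' : (fun j => z (coordRight f j)) = fun j => z' (coordRight f j)) : z = z' :=
  coordRing_algHom_ext fun s => s.rec (fun i => congrFun h i) fun j => congrFun h' j

/-- Points of the coordinate ring are points of the graph, as the graph is algebraic, and the first
projection of a graph is bijective. -/
theorem bijOn_coordLeft {f : X → Y} (hf : IsAlgebraicSet (graph f)) :
    Set.BijOn (fun (z : CoordRing (graph f) →ₐ[ℂ] ℂ) i => z (coordLeft f i)) Set.univ X := by
  refine ⟨fun z _ => ?_, fun z _ z' _ h => ?_, fun x hx => ?_⟩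
  · obtain ⟨x, hx, -⟩ := exists_apply_coordLeft_eq hf z
    exact Set.mem_of_eq_of_mem hx x.2
  · obtain ⟨x, hx, hy⟩ := exists_apply_coordLeft_eq hf z
    obtain ⟨x', hx', hy'⟩ := exists_apply_coordLeft_eq hf z'
    obtain rfl : x = x' := Subtype.ext (hx.symm.trans (h.trans hx'))
    exact algHom_graph_ext h (hy.trans hy'.symm)
  · obtain ⟨z, hz, -⟩ := exists_algHom_coordLeft_eq f ⟨x, hx⟩
    exact ⟨z, trivial, hz⟩

theorem bijOn_coordRight {f : X → Y} (hf : IsAlgebraicSet (graph f))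
    (hbij : Function.Bijective f) :
    Set.BijOn (fun (z : CoordRing (graph f) →ₐ[ℂ] ℂ) j => z (coordRight f j)) Set.univ Y := by
  refine ⟨fun z _ => ?_, fun z _ z' _ h => ?_, fun y hy => ?_⟩
  · obtain ⟨x, -, hy⟩ := exists_apply_coordLeft_eq hf z
    exact Set.mem_of_eq_of_mem hy (f x).2
  · obtain ⟨x, hx, hy⟩ := exists_apply_coordLeft_eq hf z
    obtain ⟨x', hx', hy'⟩ := exists_apply_coordLeft_eq hf z'
    obtain rfl : x = x' := hbij.1 (Subtype.ext (hy.symm.trans (h.trans hy')))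
    exact algHom_graph_ext (hx.trans hx'.symm) h
  · obtain ⟨x, hx⟩ := hbij.2 ⟨y, hy⟩
    obtain ⟨z, -, hz⟩ := exists_algHom_coordLeft_eq f x
    rw [hx] at hz
    exact ⟨z, trivial, hz⟩

variable [Fintype σ] [Fintype τ]

/-- The upper Lipschitz bound makes f(x) grow at most linearly in x, so the coordinates of X alone
control the whole filtration. -/
theorem isReesIntegral_coordLeft [Nonempty X] {f : X → Y} (hf : IsAlgebraicSet (graph f))
    {K : NNReal} (hK : LipschitzWith K f) :
    IsReesIntegral (affineSpan (coordLeft f)) (affineSpan (coord (graph f))) := by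
  obtain ⟨D, hD⟩ := exists_norm_le_of_lipschitz (a := fun x : X => (x : σ → ℂ))
    (b := fun x : X => (f x : τ → ℂ)) (K := K) hK.dist_le_mul K.2
  rw [coord_graph]
  refine isReesIntegral_sumElim (isReesIntegral_of_norm_le _ _ K.2 (D := D) fun z j => ?_)
  obtain ⟨x, hx, hy⟩ := exists_apply_coordLeft_eq hf z
  rw [hx]
  exact (norm_le_pi_norm (fun j => z (coordRight f j)) j).trans (hy ▸ hD x)

/-- The mirror image: the lower bound makes x grow at most linearly in f(x). -/
theorem isReesIntegral_coordRight [Nonempty X] {f : X → Y} (hf : IsAlgebraicSet (graph f))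
    {K : NNReal} (hK : AntilipschitzWith K f) :
    IsReesIntegral (affineSpan (coordRight f)) (affineSpan (coord (graph f))) := by
  obtain ⟨D, hD⟩ := exists_norm_le_of_lipschitz (a := fun x : X => (f x : τ → ℂ))
    (b := fun x : X => (x : σ → ℂ)) (K := K) hK.le_mul_dist K.2
  have h : IsReesIntegral (affineSpan (coordRight f)) (affineSpan (coordLeft f)) := by
    refine isReesIntegral_of_norm_le _ _ K.2 (D := D) fun z i => ?_
    obtain ⟨x, hx, hy⟩ := exists_apply_coordLeft_eq hf z
    rw [hy]
    exact (norm_le_pi_norm (fun i => z (coordLeft f i)) i).trans (hx ▸ hD x)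
  refine fun a ha => isReesIntegral_sumElim h a (affineSpan_le _ (one_mem_affineSpan _) ?_ ha)
  rw [coord_graph]
  rintro (i | j)
  · exact mem_affineSpan (Sum.elim (coordRight f) (coordLeft f)) (.inr i)
  · exact mem_affineSpan (Sum.elim (coordRight f) (coordLeft f)) (.inl j)

/-- Forms from X and forms from Y are both compatible with the same filtration of the ring of the
graph, so each of the two ranks bounds the other. -/
theorem HasDegree.eq_of_isBiLipschitz [Nonempty X] {f : X → Y} (hf : IsAlgebraicSet (graph f))
    (hbij : Function.Bijective f) (hlip : IsBiLipschitz f) {d e : ℕ} (hd : HasDegree X d)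
    (he : HasDegree Y e) : d = e := by
  obtain ⟨K, hK, hK'⟩ := hlip
  have hG : (graph f).Nonempty := ⟨_, Classical.arbitrary X, rfl⟩
  have := nontrivial_coordRing hG
  obtain ⟨k, -, hk, -⟩ := exists_ringKrullDim_eq (CoordRing (graph f))
  have hgen := adjoin_range_coord (graph f)
  obtain ⟨t, ht, htf, htd⟩ := exists_rankOver_eq hG (coordLeft f) _ (coordLeft_mem_affineSpan f)
    hgen (isReesIntegral_coordLeft hf hK) (bijOn_coordLeft hf) hk hd
  obtain ⟨t', ht', htf', hte⟩ := exists_rankOver_eq hG (coordRight f) _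
    (coordRight_mem_affineSpan f) hgen (isReesIntegral_coordRight hf hK')
    (bijOn_coordRight hf hbij) hk he
  rw [← htd, ← hte]
  exact le_antisymm (rankOver_le_of_isFilteredFinite hgen t t' ht htf')
    (rankOver_le_of_isFilteredFinite hgen t' t ht' htf)

end Graph

end AffineDegree

/-- Algebraic bi-Lipschitz homeomorphisms preserve the degree: the degrees of `X` and `Y` exist and
are equal. -/
theorem theorem3p4 (n m : ℕ) (X : Set (Fin n → ℂ)) (Y : Set (Fin m → ℂ))
    (hX : AffineDegree.IsAlgebraicSet X) (hY : AffineDegree.IsAlgebraicSet Y) (hne : X.Nonempty)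
    (f : X ≃ₜ Y) (hf : AffineDegree.IsBiLipschitz f)
    (hgraph : AffineDegree.IsAlgebraicSet (AffineDegree.graph f)) :
    ∃ d : ℕ, AffineDegree.HasDegree X d ∧ AffineDegree.HasDegree Y d := by
  have := hne.to_subtype
  obtain ⟨d, hd⟩ := hX.exists_hasDegree hne
  obtain ⟨e, he⟩ := hY.exists_hasDegree (Set.nonempty_coe_sort.mp (this.map f))
  exact ⟨d, hd, hd.eq_of_isBiLipschitz hgraph f.bijective hf he ▸ he⟩
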